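/- For $n\ge 1$ and $w\in S_n$, let $\mathfrak S_w\in\mathbb Z[x_1,x_2,\dots]$ be the Schubert polynomial of $w$, defined recursively by $\mathfrak S_{w_0}=x_1^{n-1}x_2^{n-2}\cdots x_{n-1}$ for the longest element $w_0\in S_n$ and, for $1\le i\le n-1$, $\partial_i\mathfrak S_w=\mathfrak S_{ws_i}$ if $w(i)>w(i+1)$ and $\partial_i\mathfrak S_w=0$ if $w(i)<w(i+1)$. Here $s_i=(i,i+1)$ and $\partial_i f=\dfrac{f-s_i f}{x_i-x_{i+1}}$, where $s_i f$ is $f$ with $x_i$ and $x_{i+1}$ exchanged. Let $e^i_j$ and $h^i_j$ denote the elementary and the complete homogeneous symmetric polynomials of degree $j$ in the variables $x_1,\dots,x_i$. A standard elementary monomial (SEM) is a product $e^1_{a_1}e^2_{a_2}e^3_{a_3}\cdots$, and a complete homogeneous monomial (CHM) is a product $h^1_{a_1}h^2_{a_2}h^3_{a_3}\cdots$, where $a_1,a_2,\dots$ are nonnegative integers only finitely many of which are nonzero. A single monomial is a product $x_1^{l_1}x_2^{l_2}\cdots$ with coefficient $1$. Then, for every $n\ge 1$: 1. the number of $w\in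 S_n$ such that $\mathfrak S_w$ is a single monomial is the Catalan number $C_n=\frac{1}{n+1}\binom{2n}{n}$; 2. the number of $w\in S_n$ such that $\mathfrak S_w$ is a single SEM is the Fibonacci number $F_{2n-1}$, where $F_1=F_2=1$ and $F_{m+2}=F_{m+1}+F_m$ (that is, $1,2,5,13,34,\dots$ for $n=1,2,3,4,5,\dots$); 3. the number of $w\in S_n$ such that $\mathfrak S_w$ is a single CHM is $2^{n-1}$. -/

import Mathlib

noncomputable section

namespace Schubert

open MvPolynomial

/-- The polynomial ring `ℤ[x₁, x₂, …]`; the Lean variable `X k` is `x_{k+1}`. -/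
abbrev Poly : Type := MvPolynomial ℕ ℤ

/-- The action of the simple transposition exchanging the variables `X i` and `X (i + 1)`. -/
def swapVars (i : ℕ) : Poly →ₐ[ℤ] Poly := rename (Equiv.swap i (i + 1))

theorem dvd_sub_swapVars (i : ℕ) (f : Poly) :
    (X i - X (i + 1) : Poly) ∣ f - swapVars i f := by
  induction f using MvPolynomial.induction_on with
  | C a => simp [swapVars]
  | add p q hp hq =>
    rw [map_add]
    have := dvd_add hp hq
    convert this using 1
    ring
  | mul_X p k hp =>
    have h : (X i - X (i + 1) : Poly) ∣ X k - swapVars i (X k) := by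
      simp only [swapVars, rename_X]
      by_cases h1 : k = i
      · subst h1; simp
      · by_cases h2 : k = i + 1
        · subst h2
          exact ⟨-1, by rw [Equiv.swap_apply_right]; ring⟩
        · rw [Equiv.swap_apply_of_ne_of_ne h1 h2]; simp
    rw [map_mul]
    have := dvd_add (hp.mul_right (X k)) (h.mul_left (swapVars i p))
    convert this using 1
    ring

/-- The divided difference `∂ f = (f - s f) / (x - x')`, where `x = X i`, `x' = X (i + 1)` and
`s` exchanges these two variables: the quotient in the polynomial ring. -/
def dividedDiff (i : ℕ) (f : Poly) : Poly := (dvd_sub_swapVars i f).choose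

theorem mul_dividedDiff (i : ℕ) (f : Poly) :
    (X i - X (i + 1)) * dividedDiff i f = f - swapVars i f :=
  (dvd_sub_swapVars i f).choose_spec.symm

/-- The simple transposition of the positions `i` and `i + 1` in `S_n` (positions are counted
from `0`; the identity if `i + 1` is not a position). -/
def adj (n i : ℕ) : Equiv.Perm (Fin n) :=
  if h : i + 1 < n then Equiv.swap ⟨i, by omega⟩ ⟨i + 1, h⟩ else 1

/-- `i` is an ascent of `w`: positions `i` and `i + 1` carry increasing values. -/
def IsAscent {n : ℕ} (w : Equiv.Perm (Fin n)) (i : ℕ) : Prop :=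
  ∃ h : i + 1 < n, w ⟨i, by omega⟩ < w ⟨i + 1, h⟩

/-- `i` is a descent of `w`: positions `i` and `i + 1` carry decreasing values. -/
def IsDescent {n : ℕ} (w : Equiv.Perm (Fin n)) (i : ℕ) : Prop :=
  ∃ h : i + 1 < n, w ⟨i + 1, h⟩ < w ⟨i, by omega⟩

/-- A quantity that decreases when an ascent is turned into a descent. -/
def weight {n : ℕ} (w : Equiv.Perm (Fin n)) : ℕ := ∑ a : Fin n, (a : ℕ) * (w a : ℕ)

theorem weight_mul_adj_lt {n : ℕ} {w : Equiv.Perm (Fin n)} {i : ℕ} (h : IsAscent w i) :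
    weight (w * adj n i) < weight w := by
  obtain ⟨hi, hw⟩ := h
  have hadj : adj n i = Equiv.swap ⟨i, by omega⟩ ⟨i + 1, hi⟩ := by simp [adj, hi]
  have hne : (⟨i, by omega⟩ : Fin n) ≠ ⟨i + 1, hi⟩ := by simp
  rw [hadj]
  unfold weight
  zify
  rw [← sub_neg, ← Finset.sum_sub_distrib]
  rw [Finset.sum_eq_add_of_mem (⟨i, by omega⟩ : Fin n) ⟨i + 1, hi⟩ (Finset.mem_univ _)
    (Finset.mem_univ _) hne]
  · simp only [Function.comp_apply, Equiv.swap_apply_left,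
      Equiv.swap_apply_right]
    have : ((w ⟨i, by omega⟩ : ℕ) : ℤ) < ((w ⟨i + 1, hi⟩ : ℕ) : ℤ) := by exact_mod_cast hw
    push_cast
    nlinarith
  · rintro c - ⟨h1, h2⟩
    simp [Equiv.swap_apply_of_ne_of_ne h1 h2]

open Classical in
/-- The Schubert polynomial of `w ∈ S_n`. For the longest element (the only permutation without
ascents) it is `x₁^(n-1) x₂^(n-2) ⋯ x_(n-1)`; otherwise it is the divided difference at an ascent
`i` of `w` of the Schubert polynomial of the longer permutation `w s_i`. The choice of the ascent
is immaterial: see `schubert_longest`, `dividedDiff_schubert_of_descent` and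
`dividedDiff_schubert_of_ascent` below for the full defining recursion. -/
def schubert {n : ℕ} (w : Equiv.Perm (Fin n)) : Poly :=
  if h : ∃ i, IsAscent w i then
    dividedDiff h.choose (schubert (w * adj n h.choose))
  else ∏ k : Fin n, X (k : ℕ) ^ (n - 1 - (k : ℕ))
termination_by weight w
decreasing_by exact weight_mul_adj_lt h.choose_spec

/-! ### The defining recursion of Schubert polynomials -/

theorem X_sub_X_ne_zero {i j : ℕ} (h : i ≠ j) : (X i - X j : Poly) ≠ 0 := by
  rw [sub_ne_zero]
  exact fun e => h (X_injective e)

theorem swapVars_X (i k : ℕ) : swapVars i (X k : Poly) = X (Equiv.swap i (i + 1) k) := by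
  simp [swapVars]

theorem swapVars_swapVars (i : ℕ) (f : Poly) : swapVars i (swapVars i f) = f := by
  simp only [swapVars, rename_rename]
  have : (Equiv.swap i (i + 1) : ℕ → ℕ) ∘ Equiv.swap i (i + 1) = id := by
    funext k; simp
  rw [this, rename_id_apply]

theorem swapVars_comm {i j : ℕ} (h : i + 1 < j) (f : Poly) :
    swapVars i (swapVars j f) = swapVars j (swapVars i f) := by
  simp only [swapVars, rename_rename]
  congr 2
  funext k
  simp only [Function.comp_apply, Equiv.swap_apply_def]
  split_ifs <;> omega

theorem swapVars_braid (i : ℕ) (f : Poly) :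
    swapVars i (swapVars (i + 1) (swapVars i f)) =
      swapVars (i + 1) (swapVars i (swapVars (i + 1) f)) := by
  simp only [swapVars, rename_rename]
  congr 2
  funext k
  simp only [Function.comp_apply, Equiv.swap_apply_def]
  split_ifs <;> omega

theorem dividedDiff_eq_of_mul_eq {i : ℕ} {f g : Poly}
    (h : (X i - X (i + 1)) * g = f - swapVars i f) : dividedDiff i f = g := by
  apply mul_left_cancel₀ (X_sub_X_ne_zero (Nat.ne_of_lt (Nat.lt_succ_self i)))
  rw [mul_dividedDiff, h]

theorem swapVars_dividedDiff (i : ℕ) (f : Poly) :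
    swapVars i (dividedDiff i f) = dividedDiff i f := by
  symm
  apply dividedDiff_eq_of_mul_eq
  have h := congrArg (swapVars i) (mul_dividedDiff i f)
  simp only [map_mul, map_sub, swapVars_X, swapVars_swapVars, Equiv.swap_apply_left,
    Equiv.swap_apply_right] at h
  linear_combination -h

theorem dividedDiff_dividedDiff (i : ℕ) (f : Poly) : dividedDiff i (dividedDiff i f) = 0 := by
  apply dividedDiff_eq_of_mul_eq
  rw [swapVars_dividedDiff]; ring

theorem dividedDiff_comm {i j : ℕ} (h : i + 1 < j) (f : Poly) :
    dividedDiff i (dividedDiff j f) = dividedDiff j (dividedDiff i f) := by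
  have hi := X_sub_X_ne_zero (Nat.ne_of_lt (Nat.lt_succ_self i))
  have hj := X_sub_X_ne_zero (Nat.ne_of_lt (Nat.lt_succ_self j))
  apply mul_left_cancel₀ (mul_ne_zero hi hj)
  have e1 := mul_dividedDiff i (dividedDiff j f)
  have e2 := mul_dividedDiff j (dividedDiff i f)
  have e3 := mul_dividedDiff i f
  have e4 := mul_dividedDiff j f
  have e5 := congrArg (swapVars i) e4
  have e6 := congrArg (swapVars j) e3
  have n1 : Equiv.swap i (i + 1) j = j := Equiv.swap_apply_of_ne_of_ne (by omega) (by omega)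
  have n2 : Equiv.swap i (i + 1) (j + 1) = j + 1 :=
    Equiv.swap_apply_of_ne_of_ne (by omega) (by omega)
  have n3 : Equiv.swap j (j + 1) i = i := Equiv.swap_apply_of_ne_of_ne (by omega) (by omega)
  have n4 : Equiv.swap j (j + 1) (i + 1) = i + 1 :=
    Equiv.swap_apply_of_ne_of_ne (by omega) (by omega)
  simp only [map_mul, map_sub, swapVars_X, n1, n2, n3, n4] at e5 e6
  rw [swapVars_comm h] at e5
  simp only [Nat.succ_eq_add_one]
  linear_combination (X j - X (j + 1)) * e1 - (X i - X (i + 1)) * e2 + e4 - e5 - e3 + e6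

theorem mul_dividedDiff_three (a b c : Poly) (i j : ℕ) (f : Poly)
    (hi : (a - b) * dividedDiff i (dividedDiff j (dividedDiff i f)) =
      dividedDiff j (dividedDiff i f) - swapVars i (dividedDiff j (dividedDiff i f)))
    (hj : (b - c) * dividedDiff j (dividedDiff i f) =
      dividedDiff i f - swapVars j (dividedDiff i f))
    (hij : (a - c) * swapVars i (dividedDiff j (dividedDiff i f)) =
      dividedDiff i f - swapVars i (swapVars j (dividedDiff i f)))
    (h1 : (a - b) * dividedDiff i f = f - swapVars i f)
    (h2 : (a - c) * swapVars j (dividedDiff i f) = swapVars j f - swapVars j (swapVars i f))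
    (h3 : (b - c) * swapVars i (swapVars j (dividedDiff i f)) =
      swapVars i (swapVars j f) - swapVars i (swapVars j (swapVars i f))) :
    (a - b) * (a - c) * (b - c) * dividedDiff i (dividedDiff j (dividedDiff i f)) =
      f - swapVars i f - swapVars j f + swapVars j (swapVars i f) + swapVars i (swapVars j f)
        - swapVars i (swapVars j (swapVars i f)) := by
  linear_combination (a - c) * (b - c) * hi + (a - c) * hj - (b - c) * hij + h1 - h2 + h3

theorem dividedDiff_braid (i : ℕ) (f : Poly) :
    dividedDiff i (dividedDiff (i + 1) (dividedDiff i f)) =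
      dividedDiff (i + 1) (dividedDiff i (dividedDiff (i + 1) f)) := by
  have n0 : Equiv.swap i (i + 1) (i + 2) = i + 2 :=
    Equiv.swap_apply_of_ne_of_ne (by omega) (by omega)
  have n1 : Equiv.swap (i + 1) (i + 2) i = i :=
    Equiv.swap_apply_of_ne_of_ne (by omega) (by omega)
  have key1 := mul_dividedDiff_three (X i) (X (i + 1)) (X (i + 2)) i (i + 1) f
    (mul_dividedDiff _ _) (mul_dividedDiff _ _)
    (by
      have h := congrArg (swapVars i) (mul_dividedDiff (i + 1) (dividedDiff i f))
      simp only [map_mul, map_sub, swapVars_X, swapVars_dividedDiff, n0,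
        Equiv.swap_apply_right] at h
      exact h)
    (mul_dividedDiff _ _)
    (by
      have h := congrArg (swapVars (i + 1)) (mul_dividedDiff i f)
      simp only [map_mul, map_sub, swapVars_X, n1, Equiv.swap_apply_left] at h
      exact h)
    (by
      have h := congrArg (swapVars i) (congrArg (swapVars (i + 1)) (mul_dividedDiff i f))
      simp only [map_mul, map_sub, swapVars_X, n0, n1, Equiv.swap_apply_left] at h
      exact h)
  have key2 := mul_dividedDiff_three (-X (i + 2)) (-X (i + 1)) (-X i) (i + 1) i f
    (by linear_combination mul_dividedDiff (i + 1) (dividedDiff i (dividedDiff (i + 1) f)))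
    (by linear_combination mul_dividedDiff i (dividedDiff (i + 1) f))
    (by
      have h := congrArg (swapVars (i + 1)) (mul_dividedDiff i (dividedDiff (i + 1) f))
      simp only [map_mul, map_sub, swapVars_X, swapVars_dividedDiff, n1,
        Equiv.swap_apply_left] at h
      linear_combination h)
    (by linear_combination mul_dividedDiff (i + 1) f)
    (by
      have h := congrArg (swapVars i) (mul_dividedDiff (i + 1) f)
      simp only [map_mul, map_sub, swapVars_X, n0, Equiv.swap_apply_right] at h
      linear_combination h)
    (by
      have h := congrArg (swapVars (i + 1)) (congrArg (swapVars i) (mul_dividedDiff (i + 1) f))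
      simp only [map_mul, map_sub, swapVars_X, n0, n1, Equiv.swap_apply_right] at h
      linear_combination h)
  have a1 : (X i - X (i + 1) : Poly) ≠ 0 := X_sub_X_ne_zero (by omega)
  have a2 : (X i - X (i + 2) : Poly) ≠ 0 := X_sub_X_ne_zero (by omega)
  have a3 : (X (i + 1) - X (i + 2) : Poly) ≠ 0 := X_sub_X_ne_zero (by omega)
  apply mul_left_cancel₀ (mul_ne_zero (mul_ne_zero a1 a2) a3)
  rw [swapVars_braid] at key1
  linear_combination key1 - key2

theorem adj_apply_left {n i : ℕ} (h : i + 1 < n) :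
    adj n i ⟨i, by omega⟩ = ⟨i + 1, h⟩ := by simp [adj, h]

theorem adj_apply_right {n i : ℕ} (h : i + 1 < n) :
    adj n i ⟨i + 1, h⟩ = ⟨i, by omega⟩ := by simp [adj, h]

theorem adj_apply_of_ne {n i k : ℕ} (hk : k < n) (h1 : k ≠ i) (h2 : k ≠ i + 1) :
    adj n i ⟨k, hk⟩ = ⟨k, hk⟩ := by
  unfold adj
  split_ifs
  · exact Equiv.swap_apply_of_ne_of_ne (by simpa using h1) (by simpa using h2)
  · rfl

theorem adj_mul_self (n i : ℕ) : adj n i * adj n i = 1 := by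
  unfold adj
  split_ifs <;> simp

theorem val_adj {n i : ℕ} (h : i + 1 < n) (k : Fin n) :
    (adj n i k : ℕ) = if (k : ℕ) = i then i + 1 else if (k : ℕ) = i + 1 then i else (k : ℕ) := by
  obtain ⟨k, hk⟩ := k
  by_cases h1 : k = i
  · subst h1; simp [adj_apply_left h]
  · by_cases h2 : k = i + 1
    · subst h2; simp [adj_apply_right h]
    · simp [adj_apply_of_ne hk h1 h2, h1, h2]

theorem adj_comm {n i j : ℕ} (h : i + 1 < j) (hj : j + 1 < n) :
    adj n i * adj n j = adj n j * adj n i := by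
  ext k
  simp only [Equiv.Perm.mul_apply, val_adj hj, val_adj (show i + 1 < n by omega)]
  split_ifs <;> omega

theorem adj_braid {n i : ℕ} (hj : i + 1 + 1 < n) :
    adj n i * adj n (i + 1) * adj n i = adj n (i + 1) * adj n i * adj n (i + 1) := by
  ext k
  simp only [Equiv.Perm.mul_apply, val_adj hj, val_adj (show i + 1 < n by omega)]
  split_ifs <;> omega

theorem isAscent_mul_adj_of_lt {n i j : ℕ} {w : Equiv.Perm (Fin n)} (h : i + 1 < j)
    (hj : IsAscent w j) : IsAscent (w * adj n i) j := by
  obtain ⟨h1, h2⟩ := hj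
  refine ⟨h1, ?_⟩
  simp only [Equiv.Perm.coe_mul, Function.comp_apply]
  rwa [adj_apply_of_ne _ (by omega) (by omega), adj_apply_of_ne _ (by omega) (by omega)]

theorem isAscent_mul_adj_of_gt {n i j : ℕ} {w : Equiv.Perm (Fin n)} (h : i + 1 < j)
    (hi : IsAscent w i) : IsAscent (w * adj n j) i := by
  obtain ⟨h1, h2⟩ := hi
  refine ⟨h1, ?_⟩
  simp only [Equiv.Perm.coe_mul, Function.comp_apply]
  rwa [adj_apply_of_ne _ (by omega) (by omega), adj_apply_of_ne _ (by omega) (by omega)]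

theorem schubert_diamond {n : ℕ} {w : Equiv.Perm (Fin n)}
    (ih : ∀ v : Equiv.Perm (Fin n), weight v < weight w → ∀ i, IsAscent v i →
      schubert v = dividedDiff i (schubert (v * adj n i)))
    {i j : ℕ} (hij : i < j) (hi : IsAscent w i) (hj : IsAscent w j) :
    dividedDiff i (schubert (w * adj n i)) = dividedDiff j (schubert (w * adj n j)) := by
  have li := weight_mul_adj_lt hi
  have lj := weight_mul_adj_lt hj
  rcases Nat.lt_or_ge (i + 1) j with h | h
  · rw [ih _ li j (isAscent_mul_adj_of_lt h hj), ih _ lj i (isAscent_mul_adj_of_gt h hi),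
      dividedDiff_comm h, mul_assoc, mul_assoc, adj_comm h hj.1]
  · obtain rfl : j = i + 1 := by omega
    obtain ⟨b1, w1⟩ := hi
    obtain ⟨b2, w2⟩ := hj
    have l1 := adj_apply_left b1
    have r1 := adj_apply_right b1
    have l2 := adj_apply_left b2
    have r2 := adj_apply_right b2
    have f1 : adj n i ⟨i + 1 + 1, b2⟩ = ⟨i + 1 + 1, b2⟩ :=
      adj_apply_of_ne _ (by omega) (by omega)
    have f2 : adj n (i + 1) ⟨i, by omega⟩ = ⟨i, by omega⟩ :=
      adj_apply_of_ne _ (by omega) (by omega)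
    have A1 : IsAscent (w * adj n i) (i + 1) := by
      refine ⟨b2, ?_⟩
      simp only [Equiv.Perm.coe_mul, Function.comp_apply, r1, f1]
      exact w1.trans w2
    have A2 : IsAscent (w * adj n i * adj n (i + 1)) i := by
      refine ⟨b1, ?_⟩
      simp only [Equiv.Perm.coe_mul, Function.comp_apply, l2, f2, l1, f1]
      exact w2
    have B1 : IsAscent (w * adj n (i + 1)) i := by
      refine ⟨b1, ?_⟩
      simp only [Equiv.Perm.coe_mul, Function.comp_apply, l2, f2]
      exact w1.trans w2
    have B2 : IsAscent (w * adj n (i + 1) * adj n i) (i + 1) := by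
      refine ⟨b2, ?_⟩
      simp only [Equiv.Perm.coe_mul, Function.comp_apply, r1, f1, f2, r2]
      exact w1
    rw [ih _ li _ A1, ih _ ((weight_mul_adj_lt A1).trans li) _ A2,
      ih _ lj _ B1, ih _ ((weight_mul_adj_lt B1).trans lj) _ B2, dividedDiff_braid]
    have := adj_braid (n := n) (i := i) b2
    simp only [mul_assoc] at this ⊢
    rw [this]

theorem schubert_eq_of_ascent {n : ℕ} (w : Equiv.Perm (Fin n)) (i : ℕ) (hi : IsAscent w i) :
    schubert w = dividedDiff i (schubert (w * adj n i)) := by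
  induction hm : weight w using Nat.strong_induction_on generalizing w i with
  | _ m ih =>
    subst hm
    have ih' : ∀ v : Equiv.Perm (Fin n), weight v < weight w → ∀ i, IsAscent v i →
        schubert v = dividedDiff i (schubert (v * adj n i)) :=
      fun v hv i hi => ih _ hv v i hi rfl
    have hex : ∃ i, IsAscent w i := ⟨i, hi⟩
    rw [schubert, dif_pos hex]
    rcases lt_trichotomy hex.choose i with h | h | h
    · exact schubert_diamond ih' h hex.choose_spec hi
    · rw [h]
    · exact (schubert_diamond ih' h hi hex.choose_spec).symm

/-- The Schubert polynomial of the longest element of `S_n`. -/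
theorem schubert_longest (n : ℕ) :
    schubert (Fin.revPerm : Equiv.Perm (Fin n)) =
      ∏ k : Fin n, X (k : ℕ) ^ (n - 1 - (k : ℕ)) := by
  rw [schubert, dif_neg]
  rintro ⟨i, h, hlt⟩
  simp [Fin.lt_def] at hlt
  omega

/-- At a descent `i` of `w`, the divided difference of the Schubert polynomial of `w` is that of
the shorter permutation `w s_i`. -/
theorem dividedDiff_schubert_of_descent {n : ℕ} (w : Equiv.Perm (Fin n)) (i : ℕ)
    (hi : IsDescent w i) : dividedDiff i (schubert w) = schubert (w * adj n i) := by
  have h : IsAscent (w * adj n i) i := by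
    obtain ⟨b, hb⟩ := hi
    refine ⟨b, ?_⟩
    simpa only [Equiv.Perm.coe_mul, Function.comp_apply, adj_apply_left b,
      adj_apply_right b] using hb
  rw [schubert_eq_of_ascent _ i h, mul_assoc, adj_mul_self, mul_one]

/-- At an ascent of `w`, the divided difference of the Schubert polynomial of `w` vanishes. -/
theorem dividedDiff_schubert_of_ascent {n : ℕ} (w : Equiv.Perm (Fin n)) (i : ℕ)
    (hi : IsAscent w i) : dividedDiff i (schubert w) = 0 := by
  rw [schubert_eq_of_ascent _ i hi, dividedDiff_dividedDiff]

/-! ### Standard elementary and complete homogeneous monomials -/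

/-- `elem i j` is the elementary symmetric polynomial of degree `j` in the first `i` variables. -/
def elem (i j : ℕ) : Poly := rename Fin.val (esymm (Fin i) ℤ j)

/-- `hom i j` is the complete homogeneous symmetric polynomial of degree `j` in the first `i`
variables. -/
def hom (i j : ℕ) : Poly := rename Fin.val (hsymm (Fin i) ℤ j)

/-- `f` is a single monomial `x₁^(l₁) x₂^(l₂) ⋯` (with coefficient `1`). -/
def IsSingleMonomial (f : Poly) : Prop := ∃ l : ℕ →₀ ℕ, f = monomial l 1

/-- `f` is a single standard elementary monomial: the product over `i ≥ 1` of the elementary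
symmetric polynomials of degree `a_i` in `i` variables, with only finitely many `a_i` nonzero
(the Lean index `k` stands for `i = k + 1`). -/
def IsSingleSEM (f : Poly) : Prop := ∃ a : ℕ →₀ ℕ, f = a.prod fun k d => elem (k + 1) d

/-- `f` is a single complete homogeneous monomial: the product over `i ≥ 1` of the complete
homogeneous symmetric polynomials of degree `a_i` in `i` variables, with only finitely many `a_i`
nonzero (the Lean index `k` stands for `i = k + 1`). -/
def IsSingleCHM (f : Poly) : Prop := ∃ a : ℕ →₀ ℕ, f = a.prod fun k d => hom (k + 1) d

end Schubert

end

noncomputable section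

namespace Schubert

open MvPolynomial

/-! ### Divided differences -/

/-! The operators `dividedDiff i` preserve the set consisting of zero and the Schubert polynomials
of `S_n`, and distinct permutations have distinct Schubert polynomials (`schubert_injective`). So
each count of permutations becomes a count of exponent vectors (`card_schubert_eq`), once the
vectors giving Schubert polynomials are known and are shown to be determined by their products.
Indices below start at 0.

Monomials: the vectors are the weakly decreasing ones below the staircase. Each of these is reached
from the staircase by divided differences (`isSchubert_monomial`). Conversely, the staircase bound
is a degree bound, and monotonicity comes from positivity: the coefficient sum of `∂_i x^l` is `l_i
- l_{i+1}`, while Schubert polynomials have nonnegative coefficient sums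
(`coeffSum_schubert_nonneg`). The latter holds because the sum `∇` of all partial derivatives
commutes with divided differences and sends the staircase to a nonnegative combination of Schubert
polynomials. The count is a ballot number.

Elementary monomials: `∂_i` acts on one factor only, lowering its degree and its number of variables
by one. A factor that is not of full degree must lie far enough beyond every earlier nontrivial
factor (`IsSchubertSEM`). If it is too close, divided differences lead to one of two contradictions:
two different operators with the same nonzero image (`IsSchubert.eq_of_dividedDiff_eq`), or
neighbouring operators that commute with nonzero result
(`IsSchubert.dividedDiff_dividedDiff_succ_ne`). Conversely, `IsSchubert.mul_elem_self` and
`IsSchubert.mul_elem` append an allowed last factor. Splitting off this factor gives the recursion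
of the odd-indexed Fibonacci numbers.

Complete homogeneous monomials: here `∂_i` lowers the degree and adds a variable, so the argument is
mirrored. The condition `IsSchubertCHM` says that the intervals `[i, i + a_i]` with `a_i ≠ 0` are
disjoint and lie in `[0, n - 1]`. Such families correspond to cuttings of `n` points into
consecutive blocks, hence to the power of two. -/

theorem dividedDiff_zero (i : ℕ) : dividedDiff i 0 = 0 :=
  dividedDiff_eq_of_mul_eq (by simp)

theorem dividedDiff_add (i : ℕ) (f g : Poly) :
    dividedDiff i (f + g) = dividedDiff i f + dividedDiff i g :=
  dividedDiff_eq_of_mul_eq (by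
    rw [map_add]
    linear_combination mul_dividedDiff i f + mul_dividedDiff i g)

theorem dividedDiff_sub (i : ℕ) (f g : Poly) :
    dividedDiff i (f - g) = dividedDiff i f - dividedDiff i g :=
  dividedDiff_eq_of_mul_eq (by
    rw [map_sub]
    linear_combination mul_dividedDiff i f - mul_dividedDiff i g)

theorem dividedDiff_mul_of_left {i : ℕ} {g : Poly} (hg : swapVars i g = g) (f : Poly) :
    dividedDiff i (g * f) = g * dividedDiff i f :=
  dividedDiff_eq_of_mul_eq (by
    rw [map_mul, hg]
    linear_combination g * mul_dividedDiff i f)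

theorem dividedDiff_mul_of_right {i : ℕ} {g : Poly} (hg : swapVars i g = g) (f : Poly) :
    dividedDiff i (f * g) = dividedDiff i f * g := by
  rw [mul_comm, dividedDiff_mul_of_left hg, mul_comm]

theorem dividedDiff_of_symm {i : ℕ} {g : Poly} (hg : swapVars i g = g) : dividedDiff i g = 0 :=
  dividedDiff_eq_of_mul_eq (by rw [hg]; ring)

theorem dividedDiff_X_mul {i : ℕ} {g : Poly} (hg : swapVars i g = g) :
    dividedDiff i (X i * g) = g :=
  dividedDiff_eq_of_mul_eq (by
    rw [map_mul, hg, swapVars_X, Equiv.swap_apply_left]; ring)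

theorem swapVars_X_of_ne {i k : ℕ} (h1 : k ≠ i) (h2 : k ≠ i + 1) :
    swapVars i (X k : Poly) = X k := by
  rw [swapVars_X, Equiv.swap_apply_of_ne_of_ne h1 h2]

/-- The product with the linear form `X i - X (i + 1)` is homogeneous of degree `d + 1`, so only the
component of degree `d` of the quotient contributes to it. Cancelling the linear form shows that
this component is everything. -/
theorem isHomogeneous_dividedDiff {i d : ℕ} {f : Poly} (hf : f.IsHomogeneous (d + 1)) :
    (dividedDiff i f).IsHomogeneous d := by
  have hx : (X i - X (i + 1) : Poly).IsHomogeneous 1 :=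
    (isHomogeneous_X _ _).sub (isHomogeneous_X _ _)
  have hs : (f - swapVars i f).IsHomogeneous (d + 1) := hf.sub (hf.rename_isHomogeneous)
  have hx0 : (X i - X (i + 1) : Poly) ≠ 0 := X_sub_X_ne_zero (by omega)
  have key : dividedDiff i f = homogeneousComponent d (dividedDiff i f) := by
    apply mul_left_cancel₀ hx0
    let _ : GradedAlgebra (homogeneousSubmodule ℕ ℤ) := gradedAlgebra
    have hc (φ : Poly) (k : ℕ) : (DirectSum.decompose (homogeneousSubmodule ℕ ℤ) φ k : Poly) =
        homogeneousComponent k φ := decomposition.decompose'_apply φ k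
    have h2 := DirectSum.coe_decompose_mul_add_of_left_mem (homogeneousSubmodule ℕ ℤ) (j := d)
      (b := dividedDiff i f) ((mem_homogeneousSubmodule 1 _).2 hx)
    rw [add_comm 1 d, hc, hc] at h2
    rw [← h2, mul_dividedDiff, homogeneousComponent_eq_self hs]
  rw [key]
  exact homogeneousComponent_isHomogeneous _ _

/-! ### Inversions -/

/-- The number of inversions of a permutation. -/
def inv {n : ℕ} (w : Equiv.Perm (Fin n)) : ℕ :=
  ∑ p : Fin n × Fin n, if p.1 < p.2 ∧ w p.2 < w p.1 then 1 else 0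

theorem inv_mul_adj {n i : ℕ} {w : Equiv.Perm (Fin n)} (h : IsDescent w i) :
    inv (w * adj n i) + 1 = inv w := by
  obtain ⟨hi, hw⟩ := h
  -- Reindexing pairs of positions by the transposition moves it from the values to the order
  -- condition. That condition then changes only on the two orderings of `{i, i + 1}`.
  have e1 : inv (w * adj n i) = ∑ p : Fin n × Fin n,
      if adj n i p.1 < adj n i p.2 ∧ w p.2 < w p.1 then 1 else 0 := by
    unfold inv
    rw [← Equiv.sum_comp ((adj n i).prodCongr (adj n i))]
    have : ∀ x, adj n i (adj n i x) = x := fun x => by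
      rw [← Equiv.Perm.mul_apply, adj_mul_self]; rfl
    simp [this]
  have e2 : (1 : ℕ) = ∑ p : Fin n × Fin n,
      if p = (⟨i, by omega⟩, ⟨i + 1, hi⟩) then 1 else 0 := by simp
  rw [e1]
  refine (congrArg _ e2).trans ?_
  unfold inv
  rw [← Finset.sum_add_distrib]
  refine Finset.sum_congr rfl ?_
  rintro ⟨⟨a, ha⟩, ⟨b, hb⟩⟩ -
  simp only [Fin.lt_def, val_adj hi, Prod.mk.injEq, Fin.mk.injEq]
  by_cases hab : a = i ∧ b = i + 1
  · obtain ⟨rfl, rfl⟩ := hab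
    simpa using hw
  · by_cases hba : b = i ∧ a = i + 1
    · obtain ⟨rfl, rfl⟩ := hba
      have := Fin.lt_def.1 hw
      simp
      omega
    · rw [if_neg hab, add_zero]
      congr 1
      have : ((if a = i then i + 1 else if a = i + 1 then i else a) <
        (if b = i then i + 1 else if b = i + 1 then i else b)) ↔
          a < b := by
        split_ifs <;> omega
      rw [this]

theorem isAscent_or_isDescent {n i : ℕ} (w : Equiv.Perm (Fin n)) (hi : i + 1 < n) :
    IsAscent w i ∨ IsDescent w i := by
  rcases lt_trichotomy (w ⟨i, by omega⟩) (w ⟨i + 1, hi⟩) with h | h | h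
  · exact Or.inl ⟨hi, h⟩
  · exact absurd (w.injective h) (by simp)
  · exact Or.inr ⟨hi, h⟩

theorem isDescent_mul_adj {n i : ℕ} {w : Equiv.Perm (Fin n)} (h : IsAscent w i) :
    IsDescent (w * adj n i) i := by
  obtain ⟨b, hb⟩ := h
  refine ⟨b, ?_⟩
  simpa only [Equiv.Perm.coe_mul, Function.comp_apply, adj_apply_left b,
    adj_apply_right b] using hb

theorem eq_one_of_forall_not_isDescent {n : ℕ} {w : Equiv.Perm (Fin n)}
    (h : ∀ i, ¬ IsDescent w i) : w = 1 := by
  rw [← Equiv.Perm.monotone_iff]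
  cases n with
  | zero => exact fun a => a.elim0
  | succ n =>
    rw [Fin.monotone_iff_le_succ]
    intro i
    by_contra hc
    exact h i ⟨by omega, not_le.1 hc⟩

theorem eq_revPerm_of_forall_not_isAscent {n : ℕ} {w : Equiv.Perm (Fin n)}
    (h : ∀ i, ¬ IsAscent w i) : w = Fin.revPerm := by
  have h2 : w * Fin.revPerm = 1 := by
    apply eq_one_of_forall_not_isDescent
    rintro i ⟨hi, hd⟩
    refine h (n - 2 - i) ⟨by omega, ?_⟩
    have h3 : (⟨n - 2 - i, by omega⟩ : Fin n) = Fin.revPerm ⟨i + 1, hi⟩ := by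
      simp [Fin.ext_iff]; omega
    have h4 : (⟨n - 2 - i + 1, by omega⟩ : Fin n) = Fin.revPerm ⟨i, by omega⟩ := by
      simp [Fin.ext_iff]; omega
    rw [h3, h4]
    exact hd
  rw [mul_eq_one_iff_eq_inv] at h2
  rw [h2]
  rfl

theorem schubert_induction {n : ℕ} {P : Equiv.Perm (Fin n) → Prop} (top : P Fin.revPerm)
    (step : ∀ w i, IsAscent w i → P (w * adj n i) → P w) (w : Equiv.Perm (Fin n)) : P w := by
  induction hm : weight w using Nat.strong_induction_on generalizing w with
  | _ m ih =>
    by_cases h : ∃ i, IsAscent w i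
    · obtain ⟨i, hi⟩ := h
      exact step w i hi (ih _ (hm ▸ weight_mul_adj_lt hi) _ rfl)
    · push Not at h
      rw [eq_revPerm_of_forall_not_isAscent h]
      exact top

theorem descent_induction {n : ℕ} {P : Equiv.Perm (Fin n) → Prop} (bot : P 1)
    (step : ∀ w i, IsDescent w i → P (w * adj n i) → P w) (w : Equiv.Perm (Fin n)) : P w := by
  induction hm : inv w using Nat.strong_induction_on generalizing w with
  | _ m ih =>
    by_cases h : ∃ i, IsDescent w i
    · obtain ⟨i, hi⟩ := h
      exact step w i hi (ih _ (by have := inv_mul_adj hi; omega) _ rfl)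
    · push Not at h
      rw [eq_one_of_forall_not_isDescent h]
      exact bot

theorem eq_one_of_inv_eq_zero {n : ℕ} {w : Equiv.Perm (Fin n)} (h : inv w = 0) : w = 1 :=
  eq_one_of_forall_not_isDescent fun i hi => by have := inv_mul_adj hi; omega

theorem inv_revPerm (n : ℕ) :
    inv (Fin.revPerm : Equiv.Perm (Fin n)) = ∑ k : Fin n, (n - 1 - (k : ℕ)) := by
  unfold inv
  rw [Fintype.sum_prod_type]
  refine Finset.sum_congr rfl fun a _ => ?_
  have : ∀ b : Fin n, (a < b ∧ Fin.revPerm b < Fin.revPerm a) ↔ b ∈ Finset.Ioi a := by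
    intro b; simp
  simp only [this, Finset.sum_ite_mem, Finset.univ_inter, Finset.sum_const, smul_eq_mul, mul_one]
  simp

theorem isHomogeneous_schubert {n : ℕ} (w : Equiv.Perm (Fin n)) :
    (schubert w).IsHomogeneous (inv w) := by
  induction w using schubert_induction with
  | top =>
    rw [schubert_longest, inv_revPerm]
    exact IsHomogeneous.prod _ _ _ fun k _ => isHomogeneous_X_pow _ _
  | step w i hi ih =>
    rw [schubert_eq_of_ascent w i hi]
    apply isHomogeneous_dividedDiff
    have := inv_mul_adj (isDescent_mul_adj hi)
    rw [mul_assoc, adj_mul_self, mul_one] at this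
    rwa [this]

/-- `f` is the Schubert polynomial of a permutation in `S_n`. -/
def IsSchubert (n : ℕ) (f : Poly) : Prop := ∃ w : Equiv.Perm (Fin n), schubert w = f

/-! ### Monomials with weakly decreasing exponents -/

theorem prod_X_pow_eq_monomial {n : ℕ} {l : ℕ →₀ ℕ} (h : ∀ k, n ≤ k → l k = 0) :
    ∏ k ∈ Finset.range n, (X k : Poly) ^ l k = monomial l 1 := by
  rw [monomial_eq, C_1, one_mul]
  refine (Finsupp.prod_of_support_subset _ (fun k hk => ?_) _ (by simp)).symm
  by_contra hc
  exact Finsupp.mem_support_iff.1 hk (h k (by simpa using hc))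

theorem swapVars_monomial {i : ℕ} (l : ℕ →₀ ℕ) :
    swapVars i (monomial l 1) = monomial (l.mapDomain (Equiv.swap i (i + 1))) 1 := by
  rw [swapVars, rename_monomial]

theorem swapVars_monomial_of_eq {i : ℕ} {l : ℕ →₀ ℕ} (h : l i = l (i + 1)) :
    swapVars i (monomial l 1) = monomial l 1 := by
  rw [swapVars_monomial]
  congr 2
  refine Finsupp.ext fun k => ?_
  rw [Finsupp.mapDomain_equiv_apply, Equiv.symm_swap, Equiv.swap_apply_def]
  split_ifs with h1 h2
  · rw [h1, h]
  · rw [h2, h]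
  · rfl

theorem dividedDiff_monomial_add_single {i : ℕ} {l : ℕ →₀ ℕ} (h : l i = l (i + 1)) :
    dividedDiff i (monomial (l + Finsupp.single i 1) 1) = monomial l 1 := by
  rw [← dividedDiff_X_mul (swapVars_monomial_of_eq h), X, monomial_mul, add_comm l, one_mul]

theorem IsSchubert.dividedDiff_of_ne_zero {n i : ℕ} {f : Poly} (hf : IsSchubert n f)
    (hi : i + 1 < n) (h : dividedDiff i f ≠ 0) : IsSchubert n (dividedDiff i f) := by
  obtain ⟨w, rfl⟩ := hf
  rcases isAscent_or_isDescent w hi with ha | hd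
  · exact absurd (dividedDiff_schubert_of_ascent w i ha) h
  · exact ⟨_, (dividedDiff_schubert_of_descent w i hd).symm⟩

theorem isSchubert_staircase {n : ℕ} {l : ℕ →₀ ℕ} (h : ∀ k, l k = n - 1 - k) :
    IsSchubert n (monomial l 1) := by
  refine ⟨Fin.revPerm, ?_⟩
  rw [schubert_longest, ← prod_X_pow_eq_monomial (n := n) (fun k hk => by rw [h]; omega),
    Finset.prod_range]
  simp only [h]

/-- Induction on the distance to the staircase. At the least `i` with `l i = l (i + 1)`, raising `l
i` by one gives a vector of the same kind: minimality leaves room on the left, and `l i = l (i + 1)`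
leaves room below the staircase. The operator at `i` leads back to `l`. If there is no such `i`,
strict decrease forces the staircase. -/
theorem isSchubert_monomial {n : ℕ} {l : ℕ →₀ ℕ} (hl : Antitone l) (hb : ∀ k, l k ≤ n - 1 - k) :
    IsSchubert n (monomial l 1) := by
  induction hm : ∑ k ∈ Finset.range n, (n - 1 - k - l k) using Nat.strong_induction_on
    generalizing l with
  | _ m ih =>
    classical
    by_cases hex : ∃ i, i + 1 < n ∧ l i = l (i + 1)
    · obtain ⟨hi, he⟩ := Nat.find_spec hex
      have hmin : ∀ j, j < Nat.find hex → l j ≠ l (j + 1) := fun j hj hjl =>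
        Nat.find_min hex hj ⟨by omega, hjl⟩
      generalize Nat.find hex = i at hi he hmin
      have hv : ∀ k, (l + Finsupp.single i 1 : ℕ →₀ ℕ) k = if k = i then l i + 1 else l k := by
        intro k
        rw [Finsupp.add_apply, Finsupp.single_apply]
        by_cases hk : k = i
        · rw [if_pos hk.symm, if_pos hk, hk]
        · rw [if_neg (Ne.symm hk), if_neg hk, add_zero]
      have hs := hb (i + 1)
      rw [← dividedDiff_monomial_add_single he]
      refine (ih _ ?_ (l := l + Finsupp.single i 1) ?_ ?_ rfl).dividedDiff_of_ne_zero hi ?_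
      · rw [← hm]
        refine Finset.sum_lt_sum (fun k _ => ?_) ⟨i, Finset.mem_range.2 (by omega), ?_⟩
        · rw [hv]; split_ifs with hk
          · subst hk; omega
          · rfl
        · rw [hv, if_pos rfl]; omega
      · refine antitone_nat_of_succ_le fun k => ?_
        rw [hv, hv]
        have : l (k + 1) ≤ l k := hl (Nat.le_succ k)
        split_ifs with h1 h2 h2
        · omega
        · subst h1
          have h3 : l k ≠ l (k + 1) := hmin k (by omega)
          omega
        · subst h2; omega
        · exact this
      · intro k
        rw [hv]
        have := hb k
        split_ifs with h1
        · subst h1; omega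
        · exact this
      · rw [dividedDiff_monomial_add_single he]
        exact (monomial_eq_zero).not.2 one_ne_zero
    · push Not at hex
      apply isSchubert_staircase
      -- Strict decrease read from the right end: each step to the left gains at least one.
      have key : ∀ j, j ≤ n - 1 → j ≤ l (n - 1 - j) := by
        intro j
        induction j with
        | zero => intro _; exact Nat.zero_le _
        | succ j ihj =>
          intro hj
          have h1 := ihj (by omega)
          have h2 := hex (n - 1 - (j + 1)) (by omega)
          have h3 := hl (Nat.le_succ (n - 1 - (j + 1)))
          have h4 : n - 1 - (j + 1) + 1 = n - 1 - j := by omega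
          rw [Nat.succ_eq_add_one, h4] at h3
          rw [h4] at h2
          omega
      intro k
      refine le_antisymm (hb k) ?_
      by_cases hk : k ≤ n - 1
      · have := key (n - 1 - k) (by omega)
        rwa [Nat.sub_sub_self hk] at this
      · omega

/-! ### Schubert polynomials determine their permutations -/

/-- The constant monomial is the Schubert polynomial of some permutation, and its degree 0 leaves
that permutation no inversions. -/
theorem schubert_one (n : ℕ) : schubert (1 : Equiv.Perm (Fin n)) = 1 := by
  obtain ⟨w, hw⟩ := isSchubert_monomial (n := n) (l := 0) (fun _ _ _ => le_rfl)
    (fun _ => Nat.zero_le _)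
  have h1 : (monomial (0 : ℕ →₀ ℕ) (1 : ℤ)) = 1 := rfl
  rw [h1] at hw
  have h2 := isHomogeneous_schubert w
  rw [hw] at h2
  have h3 := h2.inj_right (isHomogeneous_one ℕ ℤ) one_ne_zero
  rw [← eq_one_of_inv_eq_zero h3, hw]

theorem schubert_ne_zero {n : ℕ} (w : Equiv.Perm (Fin n)) : schubert w ≠ 0 := by
  induction w using descent_induction with
  | bot => rw [schubert_one]; exact one_ne_zero
  | step w i hi ih =>
    intro h
    rw [← dividedDiff_schubert_of_descent w i hi, h, dividedDiff_zero] at ih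
    exact ih rfl

theorem isDescent_of_dividedDiff_ne_zero {n i : ℕ} {w : Equiv.Perm (Fin n)} (hi : i + 1 < n)
    (h : dividedDiff i (schubert w) ≠ 0) : IsDescent w i :=
  (isAscent_or_isDescent w hi).resolve_left fun ha => h (dividedDiff_schubert_of_ascent w i ha)

theorem dividedDiff_schubert_ne_zero {n i : ℕ} {w : Equiv.Perm (Fin n)} (h : IsDescent w i) :
    dividedDiff i (schubert w) ≠ 0 := by
  rw [dividedDiff_schubert_of_descent w i h]
  exact schubert_ne_zero _

/-- The descents of a permutation can be read off its polynomial, as the positions below `n - 1`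
where the divided difference is nonzero. Induction along a common descent does the rest. -/
theorem schubert_injective (n : ℕ) :
    Function.Injective (schubert : Equiv.Perm (Fin n) → Poly) := by
  intro w
  induction w using descent_induction with
  | bot =>
    intro v h
    refine (eq_one_of_forall_not_isDescent fun i hi => dividedDiff_schubert_ne_zero hi ?_).symm
    rw [← h, schubert_one]
    exact dividedDiff_of_symm (map_one _)
  | step w i hi ih =>
    intro v h
    have hv : IsDescent v i :=
      isDescent_of_dividedDiff_ne_zero hi.1 (h ▸ dividedDiff_schubert_ne_zero hi)
    have := ih (a₂ := v * adj n i) (by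
      rw [← dividedDiff_schubert_of_descent w i hi, ← dividedDiff_schubert_of_descent v i hv, h])
    exact mul_right_cancel this

/-! ### Exponents of Schubert polynomials -/

theorem degreeOf_swapVars (i k : ℕ) (f : Poly) :
    degreeOf k (swapVars i f) = degreeOf (Equiv.swap i (i + 1) k) f := by
  conv_lhs => rw [← Equiv.swap_apply_self i (i + 1) k]
  exact degreeOf_rename_of_injective (Equiv.injective _) _

theorem degreeOf_dividedDiff_le {i k : ℕ} {f : Poly} (h : dividedDiff i f ≠ 0) :
    degreeOf k (X i - X (i + 1) : Poly) + degreeOf k (dividedDiff i f) ≤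
      max (degreeOf k f) (degreeOf (Equiv.swap i (i + 1) k) f) := by
  rw [← degreeOf_mul_eq (X_sub_X_ne_zero (by omega)) h, mul_dividedDiff, ← degreeOf_swapVars]
  exact degreeOf_sub_le _ _ _

theorem one_le_degreeOf_X_sub_X {i j : ℕ} (h : i ≠ j) :
    1 ≤ degreeOf i (X i - X j : Poly) ∧ 1 ≤ degreeOf j (X i - X j : Poly) := by
  constructor
  · have : coeff (Finsupp.single i 1) (X i - X j : Poly) ≠ 0 := by
      classical
      rw [coeff_sub, coeff_X, coeff_X, if_pos rfl, if_neg]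
      · simp
      · intro he
        exact h ((Finsupp.single_left_inj one_ne_zero).1 he).symm
    have := monomial_le_degreeOf i (mem_support_iff.2 this)
    simpa using this
  · have : coeff (Finsupp.single j 1) (X i - X j : Poly) ≠ 0 := by
      classical
      rw [coeff_sub, coeff_X, coeff_X, if_pos rfl, if_neg]
      · simp
      · intro he
        exact h ((Finsupp.single_left_inj one_ne_zero).1 he)
    have := monomial_le_degreeOf j (mem_support_iff.2 this)
    simpa using this

theorem degreeOf_schubert_le {n : ℕ} (w : Equiv.Perm (Fin n)) (k : ℕ) :
    degreeOf k (schubert w) ≤ n - 1 - k := by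
  induction w using schubert_induction generalizing k with
  | top =>
    rw [schubert_longest]
    refine (degreeOf_prod_le _ _ _).trans ?_
    by_cases hk : k < n
    · rw [Finset.sum_eq_single (⟨k, hk⟩ : Fin n)]
      · refine (degreeOf_pow_le _ _ _).trans ?_
        simp
      · intro b _ hb
        refine Nat.eq_zero_of_le_zero ((degreeOf_pow_le _ _ _).trans ?_)
        rw [degreeOf_X_of_ne, mul_zero]
        rintro rfl
        exact hb rfl
      · simp
    · refine (Finset.sum_eq_zero fun b _ => ?_).le.trans (Nat.zero_le _)
      refine Nat.eq_zero_of_le_zero ((degreeOf_pow_le _ _ _).trans ?_)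
      rw [degreeOf_X_of_ne, mul_zero]
      have := b.2
      omega
  | step w i hi ih =>
    have h0 := schubert_ne_zero w
    rw [schubert_eq_of_ascent w i hi] at h0 ⊢
    have h1 := degreeOf_dividedDiff_le (k := k) h0
    -- Division by `X i - X (i + 1)` lowers the degree in both variables by one, which is exactly
    -- what the smaller bound for the variable `i + 1` needs.
    have h2 := one_le_degreeOf_X_sub_X (show i ≠ i + 1 by omega)
    have hi' := hi.1
    by_cases hk : k = i
    · subst hk
      rw [Equiv.swap_apply_left] at h1
      have := ih k
      have := ih (k + 1)
      omega
    · by_cases hk2 : k = i + 1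
      · subst hk2
        rw [Equiv.swap_apply_right] at h1
        have := ih i
        have := ih (i + 1)
        omega
      · rw [Equiv.swap_apply_of_ne_of_ne hk hk2] at h1
        have := ih k
        omega

theorem dividedDiff_schubert_of_le {n i : ℕ} (w : Equiv.Perm (Fin n)) (hi : n ≤ i + 1) :
    dividedDiff i (schubert w) = 0 := by
  by_contra h
  have h1 := degreeOf_dividedDiff_le (k := i) h
  rw [Equiv.swap_apply_left] at h1
  have h2 := one_le_degreeOf_X_sub_X (show i ≠ i + 1 by omega)
  have h3 := degreeOf_schubert_le w i
  have h4 := degreeOf_schubert_le w (i + 1)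
  omega

/-! ### Divided differences on the set of Schubert polynomials, and two obstructions. -/

theorem IsSchubert.ne_zero {n : ℕ} {f : Poly} (h : IsSchubert n f) : f ≠ 0 := by
  obtain ⟨w, rfl⟩ := h
  exact schubert_ne_zero w

theorem IsSchubert.lt_of_dividedDiff_ne_zero {n i : ℕ} {f : Poly} (hf : IsSchubert n f)
    (h : dividedDiff i f ≠ 0) : i + 1 < n := by
  obtain ⟨w, rfl⟩ := hf
  by_contra hc
  exact h (dividedDiff_schubert_of_le w (by omega))

theorem IsSchubert.dividedDiff {n i : ℕ} {f : Poly} (hf : IsSchubert n f)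
    (h : dividedDiff i f ≠ 0) : IsSchubert n (dividedDiff i f) :=
  hf.dividedDiff_of_ne_zero (hf.lt_of_dividedDiff_ne_zero h) h

/-- First obstruction: by injectivity, equal nonzero images would give `w s_i = w s_j`. -/
theorem IsSchubert.eq_of_dividedDiff_eq {n i j : ℕ} {f : Poly} (hf : IsSchubert n f)
    (h : Schubert.dividedDiff i f ≠ 0)
    (he : Schubert.dividedDiff i f = Schubert.dividedDiff j f) : i = j := by
  have hi := hf.lt_of_dividedDiff_ne_zero h
  have hj := hf.lt_of_dividedDiff_ne_zero (he ▸ h)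
  obtain ⟨w, rfl⟩ := hf
  have di := isDescent_of_dividedDiff_ne_zero hi h
  have dj := isDescent_of_dividedDiff_ne_zero hj (he ▸ h)
  rw [dividedDiff_schubert_of_descent w i di, dividedDiff_schubert_of_descent w j dj] at he
  have h1 := mul_left_cancel (schubert_injective n he)
  have h2 := val_adj hi ⟨i, by omega⟩
  rw [h1, val_adj hj] at h2
  simp only [if_true] at h2
  split_ifs at h2 <;> omega

/-- Second obstruction: by injectivity, equality would make the neighbouring transpositions `s_i`
and `s_{i+1}` commute. -/
theorem IsSchubert.dividedDiff_dividedDiff_succ_ne {n i : ℕ} {f : Poly} (hf : IsSchubert n f)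
    (h : Schubert.dividedDiff i (Schubert.dividedDiff (i + 1) f) ≠ 0) :
    Schubert.dividedDiff i (Schubert.dividedDiff (i + 1) f) ≠
      Schubert.dividedDiff (i + 1) (Schubert.dividedDiff i f) := by
  intro he
  have h1 : Schubert.dividedDiff (i + 1) f ≠ 0 := fun h0 => h (by rw [h0, dividedDiff_zero])
  have h2 : Schubert.dividedDiff i f ≠ 0 := fun h0 => (he ▸ h) (by rw [h0, dividedDiff_zero])
  have hj := hf.lt_of_dividedDiff_ne_zero h1
  have hi : i + 1 < n := by omega
  obtain ⟨w, rfl⟩ := hf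
  have di := isDescent_of_dividedDiff_ne_zero hi h2
  have dj := isDescent_of_dividedDiff_ne_zero hj h1
  rw [dividedDiff_schubert_of_descent w i di, dividedDiff_schubert_of_descent w _ dj] at he
  rw [dividedDiff_schubert_of_descent w _ dj] at h
  have dij := isDescent_of_dividedDiff_ne_zero hi h
  have dji := isDescent_of_dividedDiff_ne_zero hj (he ▸ h)
  rw [dividedDiff_schubert_of_descent _ i dij, dividedDiff_schubert_of_descent _ _ dji] at he
  have h1 := schubert_injective n he
  rw [mul_assoc, mul_assoc] at h1
  have h1 := mul_left_cancel h1
  have h2 := congrArg (fun σ : Equiv.Perm (Fin n) => (σ ⟨i, by omega⟩ : ℕ)) h1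
  simp only [Equiv.Perm.mul_apply, val_adj hi, val_adj hj] at h2
  split_ifs at h2 <;> omega

/-- `f` is zero or the Schubert polynomial of a permutation in `S_n`. -/
def IsSchubertOrZero (n : ℕ) (f : Poly) : Prop := f = 0 ∨ IsSchubert n f

theorem IsSchubertOrZero.dividedDiff {n : ℕ} {f : Poly} (hf : IsSchubertOrZero n f) (i : ℕ) :
    IsSchubertOrZero n (dividedDiff i f) := by
  rcases hf with rfl | hf
  · exact Or.inl (dividedDiff_zero i)
  · by_cases h : Schubert.dividedDiff i f = 0
    · exact Or.inl h
    · exact Or.inr (hf.dividedDiff h)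

theorem IsSchubertOrZero.isSchubert {n : ℕ} {f : Poly} (hf : IsSchubertOrZero n f) (h : f ≠ 0) :
    IsSchubert n f := hf.resolve_left h

theorem IsSchubertOrZero.isSchubert_of_dividedDiff {n i : ℕ} {f : Poly}
    (hf : IsSchubertOrZero n f) (h : Schubert.dividedDiff i f ≠ 0) : IsSchubert n f :=
  hf.isSchubert fun h0 => h (by rw [h0, dividedDiff_zero])

/-! ### Elementary symmetric polynomials -/

theorem elem_eq_esymm (k d : ℕ) :
    elem k d = ((Multiset.range k).map (X : ℕ → Poly)).esymm d := by
  have h : (rename Fin.val : MvPolynomial (Fin k) ℤ →ₐ[ℤ] Poly) =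
      aeval (fun i : Fin k => (X (i : ℕ) : Poly)) := by
    ext; simp
  rw [elem, h, aeval_esymm_eq_multiset_esymm]
  congr 1
  have h2 : Finset.range k = (Finset.univ : Finset (Fin k)).map Fin.valEmbedding := by
    ext a
    simp
  rw [← Finset.range_val, h2, Finset.map_val, Multiset.map_map]
  rfl

theorem elem_zero_right (k : ℕ) : elem k 0 = 1 := by
  simp [elem]

theorem elem_zero_succ (d : ℕ) : elem 0 (d + 1) = 0 := by
  simp [elem_eq_esymm, Multiset.esymm, Multiset.powersetCard_zero_right]

theorem elem_succ_succ (k d : ℕ) :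
    elem (k + 1) (d + 1) = elem k (d + 1) + X k * elem k d := by
  simp only [elem_eq_esymm, Multiset.range_succ, Multiset.map_cons, Multiset.esymm,
    Multiset.powersetCard_cons, Multiset.map_add, Multiset.sum_add, Multiset.map_map]
  congr 1
  simp [Multiset.sum_map_mul_left]

theorem swapVars_rename_of_lt {i k : ℕ} (hi : i + 1 < k) {p : MvPolynomial (Fin k) ℤ}
    (hp : p.IsSymmetric) : swapVars i (rename Fin.val p) = rename Fin.val p := by
  conv_rhs => rw [← hp (Equiv.swap ⟨i, by omega⟩ ⟨i + 1, hi⟩)]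
  rw [swapVars, rename_rename, rename_rename]
  congr 2
  funext a
  simp only [Function.comp_apply, Equiv.swap_apply_def, Fin.ext_iff]
  split_ifs <;> rfl

theorem swapVars_rename_of_ge {i k : ℕ} (hi : k ≤ i) (p : MvPolynomial (Fin k) ℤ) :
    swapVars i (rename Fin.val p) = rename Fin.val p := by
  rw [swapVars, rename_rename]
  congr 2
  funext a
  have := a.2
  exact Equiv.swap_apply_of_ne_of_ne (by omega) (by omega)

theorem swapVars_elem {i k : ℕ} (h : i + 1 ≠ k) (d : ℕ) : swapVars i (elem k d) = elem k d := by
  rcases Nat.lt_or_gt_of_ne h with h | h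
  · exact swapVars_rename_of_lt h (esymm_isSymmetric _ _ _)
  · exact swapVars_rename_of_ge (by omega) _

/-- Together with `swapVars_elem` this governs elementary monomials: every factor in a number of
variables other than `i + 1` is a scalar for the operator at `i`. -/
theorem dividedDiff_elem (i d : ℕ) : dividedDiff i (elem (i + 1) (d + 1)) = elem i d :=
  dividedDiff_eq_of_mul_eq (by
    have h1 := elem_succ_succ i d
    have h2 := congrArg (swapVars i) h1
    rw [map_add, map_mul, swapVars_elem (show i + 1 ≠ i by omega),
      swapVars_elem (show i + 1 ≠ i by omega), swapVars_X, Equiv.swap_apply_left] at h2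
    rw [h2, h1]; ring)

theorem elem_ne_zero {k d : ℕ} (h : d ≤ k) : elem k d ≠ 0 := by
  induction d generalizing k with
  | zero => rw [elem_zero_right]; exact one_ne_zero
  | succ d ih =>
    obtain ⟨k, rfl⟩ : ∃ k', k = k' + 1 := ⟨k - 1, by omega⟩
    intro h0
    apply ih (k := k) (by omega)
    rw [← dividedDiff_elem, h0, dividedDiff_zero]

theorem elem_eq_zero {k d : ℕ} (h : k < d) : elem k d = 0 := by
  induction k generalizing d with
  | zero =>
    obtain ⟨d, rfl⟩ : ∃ d', d = d' + 1 := ⟨d - 1, by omega⟩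
    exact elem_zero_succ d
  | succ k ih =>
    obtain ⟨d, rfl⟩ : ∃ d', d = d' + 1 := ⟨d - 1, by omega⟩
    rw [elem_succ_succ, ih (by omega), ih (by omega)]; ring

theorem elem_self (k : ℕ) : elem k k = ∏ i ∈ Finset.range k, X i := by
  induction k with
  | zero => simp [elem_zero_right]
  | succ k ih => rw [elem_succ_succ, elem_eq_zero (by omega), ih, Finset.prod_range_succ]; ring

/-! ### Complete homogeneous symmetric polynomials -/

theorem hom_zero_right (k : ℕ) : hom k 0 = 1 := by
  simp [hom]

/-- A multiset of size `d + 1` either avoids `none`, or is `none` added to a multiset of size `d`.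
-/
theorem hsymm_option (σ : Type) [Fintype σ] [DecidableEq σ] (d : ℕ) :
    hsymm (Option σ) ℤ (d + 1) =
      rename some (hsymm σ ℤ (d + 1)) + X none * hsymm (Option σ) ℤ d := by
  rw [hsymm, ← Equiv.sum_comp (symOptionSuccEquiv (α := σ) (n := d)).symm, Fintype.sum_sum_type,
    add_comm]
  congr 1
  · simp only [hsymm, map_sum]
    refine Finset.sum_congr rfl fun s _ => ?_
    simp [symOptionSuccEquiv, map_multiset_prod]
  · simp only [hsymm, Finset.mul_sum]
    refine Finset.sum_congr rfl fun s _ => ?_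
    change (Multiset.map X (none ::ₘ s.1)).prod = _
    rw [Multiset.map_cons, Multiset.prod_cons]

theorem hom_succ_succ (k d : ℕ) :
    hom (k + 1) (d + 1) = hom k (d + 1) + X k * hom (k + 1) d := by
  have e : ∀ m, hom (k + 1) m =
      rename (fun o : Option (Fin k) => o.elim k Fin.val) (hsymm (Option (Fin k)) ℤ m) := by
    intro m
    rw [hom, ← rename_hsymm (Fin (k + 1)) ℤ m finSuccEquivLast,
      rename_rename]
    congr 2
    funext a
    refine Fin.lastCases ?_ (fun b => ?_) a <;> simp
  rw [e, e, hsymm_option, map_add, map_mul, rename_X, rename_rename]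
  rfl

theorem swapVars_hom {i k : ℕ} (h : i + 1 ≠ k) (d : ℕ) : swapVars i (hom k d) = hom k d := by
  rcases Nat.lt_or_gt_of_ne h with h | h
  · exact swapVars_rename_of_lt h (hsymm_isSymmetric _ _ _)
  · exact swapVars_rename_of_ge (by omega) _

/-- Expand `hom (i + 2) (d + 1)` along its last variable and exchange the last two variables. The
left side is symmetric, so subtracting the two expansions leaves the claim. -/
theorem dividedDiff_hom (i d : ℕ) : dividedDiff i (hom (i + 1) (d + 1)) = hom (i + 2) d :=
  dividedDiff_eq_of_mul_eq (by
    have h1 := hom_succ_succ (i + 1) d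
    have h2 := congrArg (swapVars i) h1
    rw [map_add, map_mul, swapVars_hom (show i + 1 ≠ i + 1 + 1 by omega),
      swapVars_hom (show i + 1 ≠ i + 1 + 1 by omega), swapVars_X, Equiv.swap_apply_right] at h2
    linear_combination h1 - h2)

theorem dividedDiff_X_mul_hom (i d : ℕ) :
    dividedDiff i (X i * hom (i + 1) d) = hom (i + 2) d := by
  have h : X i * hom (i + 1) d = hom (i + 1) (d + 1) - hom i (d + 1) := by
    rw [hom_succ_succ]; ring
  rw [h, dividedDiff_sub, dividedDiff_hom, dividedDiff_of_symm (swapVars_hom (by omega) _), sub_zero]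

theorem hom_ne_zero (k d : ℕ) : hom (k + 1) d ≠ 0 := by
  induction d generalizing k with
  | zero => rw [hom_zero_right]; exact one_ne_zero
  | succ d ih =>
    intro h0
    apply ih (k + 1)
    rw [← dividedDiff_hom, h0, dividedDiff_zero]

/-! ### Products of Schubert polynomials with symmetric polynomials -/

/-- The Schubert polynomial `x₁^(n-1) x₂^(n-2) ⋯ x_(n-1)` of the longest element of `S_n`. -/
def staircase (n : ℕ) : Poly := ∏ k ∈ Finset.range n, X k ^ (n - 1 - k)

theorem isSchubert_induction {n : ℕ} {P : Poly → Prop} (top : P (staircase n))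
    (step : ∀ f i, i + 1 < n → P f → P (dividedDiff i f)) {f : Poly} (hf : IsSchubert n f) :
    P f := by
  obtain ⟨w, rfl⟩ := hf
  induction w using schubert_induction with
  | top =>
    rw [schubert_longest]
    rw [staircase, Finset.prod_range] at top
    exact top
  | step w i hi ih =>
    rw [schubert_eq_of_ascent w i hi]
    exact step _ i hi.1 ih

/-- Multiplication by `g` commutes with all the operators that produce the Schubert polynomials of
`S_n` from the staircase, so the staircase is the only case to check. -/
theorem IsSchubert.mul_symm {n N : ℕ} {f g : Poly} (hf : IsSchubert n f)
    (hg : ∀ i, i + 1 < n → swapVars i g = g) (h : IsSchubertOrZero N (staircase n * g)) :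
    IsSchubertOrZero N (f * g) := by
  refine isSchubert_induction (P := fun f => IsSchubertOrZero N (f * g)) h (fun f i hi ih => ?_) hf
  rw [← dividedDiff_mul_of_right (hg i hi)]
  exact ih.dividedDiff i

theorem isSchubert_prod {n m : ℕ} {c : ℕ → ℕ} (hc : Antitone c) (hb : ∀ k, c k ≤ n - 1 - k)
    (hm : ∀ k, m ≤ k → c k = 0) : IsSchubert n (∏ k ∈ Finset.range m, X k ^ c k) := by
  have hs : ∀ a, c a ≠ 0 → a ∈ Finset.range m := fun a ha =>
    Finset.mem_range.2 (by by_contra h; exact ha (hm a (by omega)))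
  have := isSchubert_monomial (n := n) (l := Finsupp.onFinset (Finset.range m) c hs) hc hb
  rwa [← prod_X_pow_eq_monomial (n := m) hm] at this

theorem antitone_sub_left (n : ℕ) : Antitone fun k => n - k :=
  fun _ _ h => Nat.sub_le_sub_left h n

theorem isSchubert_staircase_poly (n : ℕ) : IsSchubert n (staircase n) :=
  isSchubert_prod (antitone_sub_left _) (fun _ => le_rfl) (fun k hk => by omega)

theorem swapVars_prod_of_notMem {i : ℕ} {s : Finset ℕ} (c : ℕ → ℕ) (h1 : i ∉ s)
    (h2 : i + 1 ∉ s) : swapVars i (∏ k ∈ s, (X k : Poly) ^ c k) = ∏ k ∈ s, X k ^ c k := by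
  rw [map_prod]
  refine Finset.prod_congr rfl fun k hk => ?_
  rw [map_pow, swapVars_X_of_ne]
  · rintro rfl; exact h1 hk
  · rintro rfl; exact h2 hk

theorem staircase_mul_elem_self (n : ℕ) : staircase n * elem n n = staircase (n + 1) := by
  rw [elem_self, staircase, staircase, ← Finset.prod_mul_distrib, Finset.prod_range_succ]
  simp only [Nat.add_sub_cancel, Nat.sub_self, pow_zero, mul_one]
  refine Finset.prod_congr rfl fun k hk => ?_
  have := Finset.mem_range.1 hk
  rw [← pow_succ]
  congr 1
  omega

theorem IsSchubert.mul_elem_self {n : ℕ} {f : Poly} (hf : IsSchubert n f) :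
    IsSchubert (n + 1) (f * elem n n) := by
  refine (hf.mul_symm (fun i hi => swapVars_elem (by omega) _) ?_).isSchubert
    (mul_ne_zero hf.ne_zero (elem_ne_zero le_rfl))
  rw [staircase_mul_elem_self]
  exact Or.inr (isSchubert_staircase_poly _)

/-! ### Appending a complete homogeneous factor -/

theorem hom_one_eq_pow (b : ℕ) : hom 1 b = X 0 ^ b := by
  induction b with
  | zero => rw [hom_zero_right, pow_zero]
  | succ b ih =>
    have h0 : hom 0 (b + 1) = 0 := by simp [hom, hsymm]
    rw [hom_succ_succ, ih, h0, zero_add, pow_succ']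

/-- These products interpolate between a weakly decreasing monomial (`j = 0`, where the last factor
is a power of `X 0`) and the staircase of `S_n` times `hom (n + 1) b` (`j = n`). The operator at `j`
leads from each one to the next. -/
theorem isSchubert_prod_mul_hom {n b j : ℕ} (hj : j ≤ n) :
    IsSchubertOrZero (n + 1 + b) ((∏ k ∈ Finset.range j, X k ^ (n - 1 - k)) *
      (∏ k ∈ Finset.Ico j (n + 1), X k ^ (n - k)) * hom (j + 1) b) := by
  induction j with
  | zero =>
    right
    have := isSchubert_prod (n := n + 1 + b) (m := n + 1)
      (c := fun k => n - k + if k = 0 then b else 0) ?_ ?_ ?_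
    · convert this using 1
      simp only [pow_add, Finset.prod_mul_distrib]
      rw [Finset.range_zero, Finset.prod_empty, one_mul, hom_one_eq_pow, Finset.range_eq_Ico]
      congr 1
      rw [Finset.prod_eq_single 0]
      · simp
      · intro k _ hk; simp [hk]
      · simp
    · refine antitone_nat_of_succ_le fun k => ?_
      change n - (k + 1) + (if k + 1 = 0 then b else 0) ≤ n - k + if k = 0 then b else 0
      rw [if_neg (Nat.succ_ne_zero k)]
      omega
    · intro k
      split_ifs <;> omega
    · intro k hk
      split_ifs <;> omega
  | succ j ih =>
    have h := (ih (by omega)).dividedDiff j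
    convert h using 1
    -- The exponents of `X j` and `X (j + 1)` differ by one. Apart from one spare `X j`, which joins
    -- the complete homogeneous factor, everything is symmetric in these two variables.
    have e : (∏ k ∈ Finset.range j, X k ^ (n - 1 - k)) *
        (∏ k ∈ Finset.Ico j (n + 1), X k ^ (n - k)) * hom (j + 1) b =
        ((∏ k ∈ Finset.range j, X k ^ (n - 1 - k)) * ((X j * X (j + 1)) ^ (n - (j + 1))) *
          (∏ k ∈ Finset.Ico (j + 1 + 1) (n + 1), X k ^ (n - k))) * (X j * hom (j + 1) b) := by
      rw [Finset.prod_eq_prod_Ico_succ_bot (by omega), Finset.prod_eq_prod_Ico_succ_bot (by omega),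
        show n - j = n - (j + 1) + 1 by omega]
      ring
    rw [e, dividedDiff_mul_of_left, dividedDiff_X_mul_hom,
      Finset.prod_eq_prod_Ico_succ_bot (show j + 1 < n + 1 by omega), Finset.prod_range_succ,
      show n - 1 - j = n - (j + 1) by omega]
    · ring
    · rw [map_mul, map_mul, map_pow, map_mul, swapVars_X, swapVars_X, Equiv.swap_apply_left,
        Equiv.swap_apply_right, swapVars_prod_of_notMem, swapVars_prod_of_notMem]
      · ring
      all_goals simp

theorem IsSchubert.mul_hom {n : ℕ} {f : Poly} (hf : IsSchubert n f) (b : ℕ) :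
    IsSchubert (n + 1 + b) (f * hom (n + 1) b) := by
  refine (hf.mul_symm (fun i hi => swapVars_hom (by omega) _) ?_).isSchubert
    (mul_ne_zero hf.ne_zero (hom_ne_zero _ _))
  have := isSchubert_prod_mul_hom (b := b) (le_refl n)
  simpa [staircase] using this

/-! ### Appending an elementary factor -/

theorem swapVars_prod_Ico {m N : ℕ} (h : m + 1 < N) :
    swapVars m (∏ k ∈ Finset.Ico m N, (X k : Poly)) = ∏ k ∈ Finset.Ico m N, X k := by
  have h1 := swapVars_prod_of_notMem (i := m) (s := Finset.Ico (m + 1 + 1) N) (fun _ => 1)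
    (by simp) (by simp)
  simp only [pow_one] at h1
  rw [Finset.prod_eq_prod_Ico_succ_bot (by omega), Finset.prod_eq_prod_Ico_succ_bot h,
    map_mul, map_mul, h1, swapVars_X, swapVars_X, Equiv.swap_apply_left, Equiv.swap_apply_right]
  ring

/-- The state after applying the operators at `k + b`, then `k + b - 1`, down to `k + 1 + t`. The
difference form suits the induction: `elem (k + b + 1) b` is symmetric for all remaining operators,
so only the correction term changes. Its product of variables takes up `X (k + 1 + t)` and becomes
symmetric, while its elementary factor loses one degree and one variable. -/
theorem isSchubertOrZero_mul_elem_sub {M k b t : ℕ} {F : Poly}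
    (hF : ∀ i, k ≤ i → swapVars i F = F)
    (h : IsSchubertOrZero M (F * (∏ i ∈ Finset.Ico k (k + b + 1), X i) * elem (k + b) b))
    (ht : t < b) :
    IsSchubertOrZero M (F * (∏ i ∈ Finset.Ico k (k + 1 + t), X i) * (elem (k + b + 1) b -
      (∏ i ∈ Finset.Ico (k + 1 + t) (k + b + 1), X i) * elem (k + 1 + t) t)) := by
  have hsym : ∀ m, k ≤ m → swapVars m (F * ∏ i ∈ Finset.Ico k m, X i) =
      F * ∏ i ∈ Finset.Ico k m, X i := by
    intro m hm
    have h1 := swapVars_prod_of_notMem (i := m) (s := Finset.Ico k m) (fun _ => 1)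
      (by simp) (by simp)
    simp only [pow_one] at h1
    rw [map_mul, hF m hm, h1]
  obtain ⟨s, rfl⟩ : ∃ s, b = t + 1 + s := ⟨b - (t + 1), by omega⟩
  clear ht
  have hpull : ∀ m, k ≤ m → ∀ E : Poly, F * (∏ i ∈ Finset.Ico k (m + 1), X i) * E =
      (F * ∏ i ∈ Finset.Ico k m, X i) * (X m * E) := by
    intro m hm E
    rw [Finset.prod_Ico_succ_top hm]
    ring
  induction s generalizing t with
  | zero =>
    have h1 := h.dividedDiff (k + 1 + t)
    convert h1 using 1
    rw [show k + (t + 1 + 0) = k + 1 + t by omega, show t + 1 + 0 = t + 1 by omega,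
      hpull _ (by omega), dividedDiff_mul_of_left (hsym _ (by omega)),
      dividedDiff_X_mul (swapVars_elem (by omega) _), elem_succ_succ]
    simp
  | succ s ih =>
    have h1 := (ih (t := t + 1) (by
      rwa [show t + 1 + 1 + s = t + 1 + (s + 1) by omega])).dividedDiff (k + 1 + t)
    convert h1 using 1
    rw [show t + 1 + 1 + s = t + 1 + (s + 1) by omega, ← add_assoc (k + 1) t 1,
      hpull _ (by omega), dividedDiff_mul_of_left (hsym _ (by omega)), mul_sub (X _),
      dividedDiff_sub,
      dividedDiff_X_mul (swapVars_elem (by omega) _), ← mul_assoc (X _),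
      ← Finset.prod_eq_prod_Ico_succ_bot (by omega), dividedDiff_mul_of_left
      (swapVars_prod_Ico (by omega)), dividedDiff_elem]

/-- The last operator, at `k`, removes the remaining `X k` from the main term. It kills the
correction, which has become the product of the variables from `k` to `k + b`, symmetric in the
first two. -/
theorem isSchubertOrZero_mul_elem {M k b : ℕ} {F : Poly}
    (hF : ∀ i, k ≤ i → swapVars i F = F)
    (h : IsSchubertOrZero M (F * (∏ i ∈ Finset.Ico k (k + b + 1), X i) * elem (k + b) b)) :
    IsSchubertOrZero M (F * elem (k + b + 1) b) := by
  cases b with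
  | zero =>
    have h1 := h.dividedDiff k
    simp only [add_zero, elem_zero_right, mul_one, Nat.Ico_succ_singleton,
      Finset.prod_singleton] at h1 ⊢
    rwa [mul_comm, dividedDiff_X_mul (hF k le_rfl)] at h1
  | succ b =>
    have h1 := (isSchubertOrZero_mul_elem_sub hF h (Nat.succ_pos b)).dividedDiff k
    rw [add_zero, elem_zero_right, mul_one, Nat.Ico_succ_singleton, Finset.prod_singleton,
      mul_assoc, dividedDiff_mul_of_left (hF k le_rfl), mul_sub, dividedDiff_sub,
      dividedDiff_X_mul (swapVars_elem (by omega) _),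
      ← Finset.prod_eq_prod_Ico_succ_bot (by omega),
      dividedDiff_of_symm (swapVars_prod_Ico (by omega)), sub_zero] at h1
    exact h1

theorem isSchubertOrZero_staircase_mul_elem (n b : ℕ) :
    IsSchubertOrZero (n + b + 1) (staircase n * elem (n + b) b) := by
  induction n with
  | zero =>
    right
    have h := isSchubert_prod (n := b + 1) (m := b) (c := fun k => if k < b then 1 else 0) ?_ ?_ ?_
    · convert h using 1
      · omega
      · rw [staircase, Finset.range_zero, Finset.prod_empty, one_mul, zero_add, elem_self]
        refine Finset.prod_congr rfl fun k hk => ?_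
        rw [if_pos (Finset.mem_range.1 hk), pow_one]
    · refine antitone_nat_of_succ_le fun k => ?_
      split_ifs <;> omega
    · intro k
      split_ifs <;> omega
    · intro k hk
      split_ifs <;> omega
  | succ n ih =>
    have hne : staircase n * elem (n + b) b ≠ 0 :=
      mul_ne_zero (isSchubert_staircase_poly n).ne_zero (elem_ne_zero (by omega))
    -- Multiplying by all variables up to index `n + b` enlarges the group by one. The variables
    -- below `n` complete the next staircase, and those from `n` on are the product consumed by
    -- `isSchubertOrZero_mul_elem`.
    have h1 := (ih.isSchubert hne).mul_elem_self
    have h2 := isSchubertOrZero_mul_elem (M := n + b + 1 + 1) (k := n) (b := b)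
      (F := staircase (n + 1)) ?_ (Or.inr ?_)
    · rwa [show n + 1 + b = n + b + 1 by omega]
    · intro i hi
      rw [staircase, Finset.prod_range_succ, Nat.add_sub_cancel, Nat.sub_self, pow_zero, mul_one]
      exact swapVars_prod_of_notMem _ (by simpa using hi) (by simp; omega)
    · convert h1 using 1
      rw [elem_self (n + b + 1), ← Finset.prod_range_mul_prod_Ico _ (show n ≤ n + b + 1 by omega),
        ← staircase_mul_elem_self, elem_self]
      ring

theorem IsSchubert.mul_elem {n : ℕ} {f : Poly} (hf : IsSchubert n f) (b : ℕ) :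
    IsSchubert (n + b + 1) (f * elem (n + b) b) :=
  (hf.mul_symm (fun i hi => swapVars_elem (by omega) _)
    (isSchubertOrZero_staircase_mul_elem n b)).isSchubert
    (mul_ne_zero hf.ne_zero (elem_ne_zero (by omega)))

/-! ### Finitely supported products as products over ranges. -/

theorem finsuppProd_eq_prod_range {F : ℕ → ℕ → Poly} (hF : ∀ k, F k 0 = 1) {a : ℕ →₀ ℕ} {N : ℕ}
    (h : ∀ k, N ≤ k → a k = 0) : a.prod F = ∏ k ∈ Finset.range N, F k (a k) :=
  Finsupp.prod_of_support_subset _ (fun k hk => by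
    by_contra hc
    exact Finsupp.mem_support_iff.1 hk (h k (by simpa using hc))) _ fun k _ => hF k

theorem exists_forall_eq_zero_of_le (a : ℕ →₀ ℕ) : ∃ N, ∀ k, N ≤ k → a k = 0 := by
  refine ⟨a.support.sup id + 1, fun k hk => ?_⟩
  by_contra hc
  have := Finset.le_sup (f := id) (Finsupp.mem_support_iff.2 hc)
  simp only [id] at this
  omega

/-! ### Standard elementary monomials -/

theorem swapVars_prod_elem {i : ℕ} {s : Finset ℕ} (a : ℕ → ℕ) (h : i ∉ s) :
    swapVars i (∏ k ∈ s, elem (k + 1) (a k)) = ∏ k ∈ s, elem (k + 1) (a k) := by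
  rw [map_prod]
  refine Finset.prod_congr rfl fun k hk => swapVars_elem ?_ _
  rintro hik
  exact h ((Nat.succ_injective hik) ▸ hk)

/-- The operators at `k, k - 1, …` wear the factor down to degree 0 without touching `Q`. This
strips the factors in few variables from an elementary monomial. -/
theorem IsSchubertOrZero.of_elem_mul {n k d : ℕ} {Q : Poly} (hd : d ≤ k + 1)
    (hQ : ∀ i, i ≤ k → swapVars i Q = Q) (h : IsSchubertOrZero n (elem (k + 1) d * Q)) :
    IsSchubertOrZero n Q := by
  induction d generalizing k with
  | zero => rwa [elem_zero_right, one_mul] at h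
  | succ d ih =>
    have h1 := h.dividedDiff k
    rw [dividedDiff_mul_of_right (hQ k le_rfl), dividedDiff_elem] at h1
    cases k with
    | zero =>
      obtain rfl : d = 0 := by omega
      rwa [elem_zero_right, one_mul] at h1
    | succ k => exact ih (by omega) (fun i hi => hQ i (by omega)) h1

theorem IsSchubertOrZero.of_prod_elem_mul {n p : ℕ} {a : ℕ → ℕ} {Q : Poly}
    (ha : ∀ k, a k ≤ k + 1) (hQ : ∀ i, i < p → swapVars i Q = Q)
    (h : IsSchubertOrZero n ((∏ k ∈ Finset.range p, elem (k + 1) (a k)) * Q)) :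
    IsSchubertOrZero n Q := by
  induction p generalizing Q with
  | zero => rwa [Finset.range_zero, Finset.prod_empty, one_mul] at h
  | succ p ih =>
    rw [Finset.prod_range_succ, mul_assoc] at h
    refine (ih (fun i hi => ?_) h).of_elem_mul (ha p) fun i hi => hQ i (by omega)
    rw [map_mul, swapVars_elem (by omega), hQ i (by omega)]

/-- Operators at `k, k - 1, …` bring `c` down to 0. Then the operator at the current `k` and the one
at `M` both send the product to `G`, against the first obstruction. -/
theorem not_isSchubertOrZero_elem_add_elem {n k M c : ℕ} {G : Poly} (hk : k < M) (hc : c ≤ k)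
    (hG : ∀ i, i ≤ M → swapVars i G = G) (hG0 : G ≠ 0) :
    ¬ IsSchubertOrZero n ((elem (k + 1) (c + 1) + elem (k + 1) c * elem (M + 1) 1) * G) := by
  intro h
  induction c generalizing k with
  | zero =>
    have e1 : dividedDiff k ((elem (k + 1) (0 + 1) + elem (k + 1) 0 * elem (M + 1) 1) * G) = G := by
      rw [elem_zero_right, one_mul, dividedDiff_mul_of_right (hG k hk.le), dividedDiff_add,
        dividedDiff_elem, dividedDiff_of_symm (swapVars_elem (by omega) _), elem_zero_right]
      ring
    have e2 : dividedDiff M ((elem (k + 1) (0 + 1) + elem (k + 1) 0 * elem (M + 1) 1) * G) = G := by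
      rw [elem_zero_right, one_mul, dividedDiff_mul_of_right (hG M le_rfl), dividedDiff_add,
        dividedDiff_elem, dividedDiff_of_symm (swapVars_elem (by omega) _), elem_zero_right]
      ring
    have h1 := h.isSchubert_of_dividedDiff (i := k) (by rwa [e1])
    have := h1.eq_of_dividedDiff_eq (i := k) (j := M) (by rwa [e1]) (by rw [e1, e2])
    omega
  | succ c ih =>
    obtain ⟨k, rfl⟩ : ∃ k', k = k' + 1 := ⟨k - 1, by omega⟩
    refine ih (k := k) (by omega) (by omega) ?_
    have h1 := h.dividedDiff (k + 1)
    rwa [dividedDiff_mul_of_right (hG _ hk.le), dividedDiff_add, dividedDiff_elem,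
      dividedDiff_mul_of_right (swapVars_elem (by omega) _), dividedDiff_elem] at h1

theorem dividedDiff_elem_one_mul_elem (p b : ℕ) :
    dividedDiff p (elem (p + 1) 1 * elem (p + 1) (b + 1)) =
      elem p (b + 1) + elem p b * elem (p + 2) 1 := by
  have h1 := elem_succ_succ (p + 1) 0
  have h2 := elem_succ_succ (p + 1) (b + 1)
  rw [elem_zero_right] at h1
  -- Replacing `elem (p + 1) 1` by `elem (p + 2) 1 - X (p + 1)` leaves at most one factor per term
  -- that is not symmetric for the operator at `p`.
  have e : elem (p + 1) 1 * elem (p + 1) (b + 1) =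
      elem (p + 2) 1 * elem (p + 1) (b + 1) - (elem (p + 2) (b + 2) - elem (p + 1) (b + 2)) := by
    linear_combination -elem (p + 1) (b + 1) * h1 + h2
  rw [e, dividedDiff_sub, dividedDiff_sub, dividedDiff_mul_of_left (swapVars_elem (by omega) _),
    dividedDiff_elem, dividedDiff_elem, dividedDiff_of_symm (swapVars_elem (by omega) _)]
  ring

/-- Neighbouring factors, the second not of full degree. If the second degree is 1, the operators at
`p` and `p + 1` commute with nonzero result. Otherwise, if the first degree is 1, two operators
produce the sum excluded by `not_isSchubertOrZero_elem_add_elem`. In the remaining case the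
operators at `p` and then `p + 1` lower both degrees and both numbers of variables, and the argument
recurs. -/
theorem not_isSchubertOrZero_elem_mul_elem_succ {n p a b : ℕ} {G : Poly} (ha : a ≤ p)
    (hb : b ≤ p) (hG : ∀ i, i ≤ p + 1 → swapVars i G = G) (hG0 : G ≠ 0) :
    ¬ IsSchubertOrZero n (elem (p + 1) (a + 1) * elem (p + 2) (b + 1) * G) := by
  intro h
  have e1 : dividedDiff (p + 1) (elem (p + 1) (a + 1) * elem (p + 2) (b + 1) * G) =
      elem (p + 1) (a + 1) * elem (p + 1) b * G := by
    rw [dividedDiff_mul_of_right (hG _ le_rfl), dividedDiff_mul_of_left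
      (swapVars_elem (by omega) _), dividedDiff_elem]
  have e2 : dividedDiff (p + 1) (dividedDiff p (elem (p + 1) (a + 1) * elem (p + 2) (b + 1) * G)) =
      elem p a * elem (p + 1) b * G := by
    rw [dividedDiff_mul_of_right (hG _ (by omega)), dividedDiff_mul_of_right
      (swapVars_elem (by omega) _), dividedDiff_elem, dividedDiff_mul_of_right (hG _ le_rfl),
      dividedDiff_mul_of_left (swapVars_elem (by omega) _), dividedDiff_elem]
  cases b with
  | zero =>
    have e3 : dividedDiff p (dividedDiff (p + 1)
        (elem (p + 1) (a + 1) * elem (p + 2) (0 + 1) * G)) = elem p a * G := by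
      rw [e1, elem_zero_right, mul_one, dividedDiff_mul_of_right (hG _ (by omega)),
        dividedDiff_elem]
    have hne : elem p a * G ≠ 0 := mul_ne_zero (elem_ne_zero ha) hG0
    rw [elem_zero_right, mul_one] at e2
    refine (h.isSchubert ?_).dividedDiff_dividedDiff_succ_ne (i := p) (by rwa [e3]) (by rw [e3, e2])
    exact mul_ne_zero (mul_ne_zero (elem_ne_zero (by omega)) (elem_ne_zero (by omega))) hG0
  | succ b =>
    obtain ⟨p, rfl⟩ : ∃ p', p = p' + 1 := ⟨p - 1, by omega⟩
    cases a with
    | zero =>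
      refine not_isSchubertOrZero_elem_add_elem (k := p) (M := p + 2) (c := b) (n := n)
        (by omega) (by omega) hG hG0 ?_
      have h1 := (h.dividedDiff (p + 1 + 1)).dividedDiff (p + 1)
      rwa [e1, dividedDiff_mul_of_right (hG _ (by omega)), dividedDiff_elem_one_mul_elem] at h1
    | succ a =>
      have h1 := (h.dividedDiff (p + 1)).dividedDiff (p + 1 + 1)
      rw [e2] at h1
      exact not_isSchubertOrZero_elem_mul_elem_succ (p := p) (by omega) (by omega)
        (fun i hi => hG i (by omega)) hG0 h1
termination_by p

/-- The operator on the larger factor shortens the gap `s` by one. Here `s ≤ b` says that its degree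
lasts until the factors are neighbours, and `b ≤ p + s` that it is not of full degree. -/
theorem not_isSchubertOrZero_elem_mul_elem {n p a b s : ℕ} {G : Poly} (ha : a ≤ p)
    (hs : s ≤ b) (hb : b ≤ p + s) (hG : ∀ i, i ≤ p + 1 + s → swapVars i G = G) (hG0 : G ≠ 0) :
    ¬ IsSchubertOrZero n (elem (p + 1) (a + 1) * elem (p + 1 + s + 1) (b + 1) * G) := by
  intro h
  induction s generalizing b with
  | zero => exact not_isSchubertOrZero_elem_mul_elem_succ ha (by omega) hG hG0 h
  | succ s ih =>
    obtain ⟨b, rfl⟩ : ∃ b', b = b' + 1 := ⟨b - 1, by omega⟩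
    refine ih (b := b) (by omega) (by omega) (fun i hi => hG i (by omega)) ?_
    have h1 := h.dividedDiff (p + 1 + (s + 1))
    rwa [dividedDiff_mul_of_right (hG _ le_rfl),
      dividedDiff_mul_of_left (swapVars_elem (by omega) _), dividedDiff_elem] at h1

/-- The exponents of the standard elementary monomials that are Schubert polynomials of `S_n`. -/
def IsSchubertSEM (n : ℕ) (a : ℕ →₀ ℕ) : Prop :=
  ∀ q, a q ≠ 0 → q + 1 < n ∧ a q ≤ q + 1 ∧ (a q ≤ q → ∀ p, p < q → a p ≠ 0 → p + a q < q)

theorem isSchubertSEM_of_isSchubert {n : ℕ} {a : ℕ →₀ ℕ}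
    (h : IsSchubert n (a.prod fun k d => elem (k + 1) d)) : IsSchubertSEM n a := by
  obtain ⟨N, hN⟩ := exists_forall_eq_zero_of_le a
  rw [finsuppProd_eq_prod_range (fun k => elem_zero_right _) hN] at h
  have hfac := Finset.prod_ne_zero_iff.1 h.ne_zero
  have hle : ∀ k, a k ≤ k + 1 := by
    intro k
    by_cases hk : k < N
    · by_contra hc
      exact hfac k (Finset.mem_range.2 hk) (elem_eq_zero (by omega))
    · rw [hN k (by omega)]; omega
  intro q hq
  have hqN : q < N := by
    by_contra hc
    exact hq (hN q (by omega))
  refine ⟨?_, hle q, ?_⟩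
  · refine h.lt_of_dividedDiff_ne_zero ?_
    rw [← Finset.mul_prod_erase _ _ (Finset.mem_range.2 hqN)]
    obtain ⟨d, hd⟩ : ∃ d, a q = d + 1 := ⟨a q - 1, by omega⟩
    have := hle q
    rw [dividedDiff_mul_of_right (swapVars_prod_elem _ (by simp)), hd, dividedDiff_elem]
    refine mul_ne_zero (elem_ne_zero (by omega)) (Finset.prod_ne_zero_iff.2 fun k hk => ?_)
    exact hfac k (Finset.mem_of_mem_erase hk)
  · intro hqq p hp hap
    by_contra hc
    -- A violation at `p` persists at the last nontrivial index before `q`, and the factors strictly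
    -- between the two are then 1.
    obtain ⟨p', hp', hmax⟩ := ((Finset.range q).filter fun k => a k ≠ 0).exists_max_image id
      ⟨p, by simp [hp, hap]⟩
    simp only [Finset.mem_filter, Finset.mem_range, id] at hp' hmax
    have hpp := hmax p ⟨hp, hap⟩
    obtain ⟨s, rfl⟩ : ∃ s, q = p' + 1 + s := ⟨q - (p' + 1), by omega⟩
    have h1 : ∏ k ∈ Finset.Ico (p' + 1) (p' + 1 + s), elem (k + 1) (a k) = 1 := by
      refine Finset.prod_eq_one fun k hk => ?_
      rw [Finset.mem_Ico] at hk
      by_cases hk0 : a k = 0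
      · rw [hk0, elem_zero_right]
      · have := hmax k ⟨hk.2, hk0⟩
        omega
    rw [← Finset.prod_range_mul_prod_Ico _ (show p' ≤ N by omega),
      Finset.prod_eq_prod_Ico_succ_bot (show p' < N by omega),
      ← Finset.prod_Ico_consecutive _ (show p' + 1 ≤ p' + 1 + s by omega) hqN.le, h1, one_mul,
      Finset.prod_eq_prod_Ico_succ_bot hqN, ← mul_assoc (elem (p' + 1) _)] at h
    have hG : ∀ i, i ≤ p' + 1 + s →
        swapVars i (∏ k ∈ Finset.Ico (p' + 1 + s + 1) N, elem (k + 1) (a k)) =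
          ∏ k ∈ Finset.Ico (p' + 1 + s + 1) N, elem (k + 1) (a k) := fun i hi =>
      swapVars_prod_elem _ (by simp; omega)
    have h2 := IsSchubertOrZero.of_prod_elem_mul hle (fun i hi => by
      rw [map_mul, map_mul, swapVars_elem (by omega), swapVars_elem (by omega),
        hG i (by omega)]) (Or.inr h)
    obtain ⟨c, hc1⟩ : ∃ c, a p' = c + 1 := ⟨a p' - 1, by omega⟩
    obtain ⟨d, hd⟩ : ∃ d, a (p' + 1 + s) = d + 1 := ⟨a (p' + 1 + s) - 1, by omega⟩
    rw [hc1, hd] at h2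
    have := hle p'
    refine not_isSchubertOrZero_elem_mul_elem (by omega) (by omega) (by omega) hG ?_ h2
    refine Finset.prod_ne_zero_iff.2 fun k hk => hfac k ?_
    rw [Finset.mem_Ico] at hk
    exact Finset.mem_range.2 hk.2

/-- Applying the operators at `k, k - 1, …`, the number of steps before a factor becomes constant
reveals its degree. -/
theorem eq_of_elem_mul_eq {k d d' : ℕ} {Q Q' : Poly} (hd : d ≤ k + 1) (hd' : d' ≤ k + 1)
    (hQ : ∀ i, i ≤ k → swapVars i Q = Q) (hQ' : ∀ i, i ≤ k → swapVars i Q' = Q')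
    (hQ0 : Q ≠ 0) (hQ0' : Q' ≠ 0) (h : elem (k + 1) d * Q = elem (k + 1) d' * Q') : d = d' := by
  have h1 := congrArg (dividedDiff k) h
  rw [dividedDiff_mul_of_right (hQ k le_rfl), dividedDiff_mul_of_right (hQ' k le_rfl)] at h1
  induction d generalizing k d' with
  | zero =>
    cases d' with
    | zero => rfl
    | succ d' =>
      rw [elem_zero_right, dividedDiff_of_symm (map_one _), dividedDiff_elem, zero_mul] at h1
      exact absurd h1.symm (mul_ne_zero (elem_ne_zero (by omega)) hQ0')
  | succ d ih =>
    cases d' with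
    | zero =>
      rw [elem_zero_right, dividedDiff_of_symm (map_one _), dividedDiff_elem, zero_mul] at h1
      exact absurd h1 (mul_ne_zero (elem_ne_zero (by omega)) hQ0)
    | succ d' =>
      rw [dividedDiff_elem, dividedDiff_elem] at h1
      cases k with
      | zero => omega
      | succ k =>
        have h2 := congrArg (dividedDiff k) h1
        rw [dividedDiff_mul_of_right (hQ k (by omega)),
          dividedDiff_mul_of_right (hQ' k (by omega))] at h2
        rw [ih (d' := d') (by omega) (by omega) (fun i hi => hQ i (by omega))
          (fun i hi => hQ' i (by omega)) h1 h2]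

theorem eq_of_prod_elem_eq {a b : ℕ →₀ ℕ} (ha : ∀ k, a k ≤ k + 1) (hb : ∀ k, b k ≤ k + 1)
    (h : (a.prod fun k d => elem (k + 1) d) = b.prod fun k d => elem (k + 1) d) : a = b := by
  obtain ⟨N, hN⟩ := exists_forall_eq_zero_of_le a
  obtain ⟨N', hN'⟩ := exists_forall_eq_zero_of_le b
  have hNa : ∀ k, max N N' ≤ k → a k = 0 := fun k hk => hN k (le_trans (le_max_left _ _) hk)
  have hNb : ∀ k, max N N' ≤ k → b k = 0 := fun k hk => hN' k (le_trans (le_max_right _ _) hk)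
  generalize max N N' = m at hNa hNb
  rw [finsuppProd_eq_prod_range (fun k => elem_zero_right _) hNa,
    finsuppProd_eq_prod_range (fun k => elem_zero_right _) hNb] at h
  have key : ∀ s j, j + s = m →
      ∏ k ∈ Finset.Ico j m, elem (k + 1) (a k) = ∏ k ∈ Finset.Ico j m, elem (k + 1) (b k) →
      ∀ k, j ≤ k → a k = b k := by
    intro s
    induction s with
    | zero => intro j hj _ k hk; rw [hNa k (by omega), hNb k (by omega)]
    | succ s ih =>
      intro j hj he k hk
      have hjm : j < m := by omega
      rw [Finset.prod_eq_prod_Ico_succ_bot hjm, Finset.prod_eq_prod_Ico_succ_bot hjm] at he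
      have hab : a j = b j := eq_of_elem_mul_eq (ha j) (hb j)
        (fun i hi => swapVars_prod_elem _ (by simp; omega))
        (fun i hi => swapVars_prod_elem _ (by simp; omega))
        (Finset.prod_ne_zero_iff.2 fun k _ => elem_ne_zero (ha k))
        (Finset.prod_ne_zero_iff.2 fun k _ => elem_ne_zero (hb k)) he
      rcases hk.eq_or_lt with rfl | hk
      · exact hab
      · rw [hab] at he
        exact ih (j + 1) (by omega) (mul_left_cancel₀ (elem_ne_zero (hb j)) he) k hk
  refine Finsupp.ext fun k => key m 0 (by omega) ?_ k (Nat.zero_le k)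
  rwa [← Finset.range_eq_Ico]

/-! ### Complete homogeneous monomials -/

theorem swapVars_prod_hom {i : ℕ} {s : Finset ℕ} (a : ℕ → ℕ) (h : i ∉ s) :
    swapVars i (∏ k ∈ s, hom (k + 1) (a k)) = ∏ k ∈ s, hom (k + 1) (a k) := by
  rw [map_prod]
  refine Finset.prod_congr rfl fun k hk => swapVars_hom ?_ _
  rintro hik
  exact h ((Nat.succ_injective hik) ▸ hk)

theorem prod_hom_ne_zero (s : Finset ℕ) (a : ℕ → ℕ) : ∏ k ∈ s, hom (k + 1) (a k) ≠ 0 :=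
  Finset.prod_ne_zero_iff.2 fun _ _ => hom_ne_zero _ _

/-- Mirror image of the elementary case: the operators at `k, k + 1, …` wear the factor down, so
factors in many variables are the ones that can be stripped. -/
theorem IsSchubertOrZero.of_hom_mul {n k d : ℕ} {Q : Poly}
    (hQ : ∀ i, k ≤ i → swapVars i Q = Q) (h : IsSchubertOrZero n (hom (k + 1) d * Q)) :
    IsSchubertOrZero n Q := by
  induction d generalizing k with
  | zero => rwa [hom_zero_right, one_mul] at h
  | succ d ih =>
    have h1 := h.dividedDiff k
    rw [dividedDiff_mul_of_right (hQ k le_rfl), dividedDiff_hom] at h1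
    exact ih (fun i hi => hQ i (by omega)) h1

theorem IsSchubertOrZero.of_prod_hom_mul {n p s : ℕ} {a : ℕ → ℕ} {Q : Poly}
    (hQ : ∀ i, p ≤ i → swapVars i Q = Q)
    (h : IsSchubertOrZero n ((∏ k ∈ Finset.Ico p (p + s), hom (k + 1) (a k)) * Q)) :
    IsSchubertOrZero n Q := by
  induction s with
  | zero => rwa [add_zero, Finset.Ico_self, Finset.prod_empty, one_mul] at h
  | succ s ih =>
    rw [← add_assoc, Finset.prod_Ico_succ_top (by omega), mul_comm _ (hom _ _), mul_assoc] at h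
    refine ih (h.of_hom_mul fun i hi => ?_)
    rw [map_mul, hQ i (by omega), swapVars_prod_hom _ (by simp; omega)]

/-- Once `c` is lowered to 0, the operators at the current `k` and at `p` both send the product to
`G`, against the first obstruction. -/
theorem not_isSchubertOrZero_hom_add_hom {n k p c : ℕ} {G : Poly} (hk : p < k)
    (hG : ∀ i, p ≤ i → swapVars i G = G) (hG0 : G ≠ 0) :
    ¬ IsSchubertOrZero n ((hom (k + 1) (c + 1) + hom (k + 1) c * hom (p + 1) 1) * G) := by
  intro h
  induction c generalizing k with
  | zero =>
    have e1 : dividedDiff k ((hom (k + 1) (0 + 1) + hom (k + 1) 0 * hom (p + 1) 1) * G) = G := by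
      rw [hom_zero_right, one_mul, dividedDiff_mul_of_right (hG k hk.le), dividedDiff_add,
        dividedDiff_hom, dividedDiff_of_symm (swapVars_hom (by omega) _), hom_zero_right]
      ring
    have e2 : dividedDiff p ((hom (k + 1) (0 + 1) + hom (k + 1) 0 * hom (p + 1) 1) * G) = G := by
      rw [hom_zero_right, one_mul, dividedDiff_mul_of_right (hG p le_rfl), dividedDiff_add,
        dividedDiff_hom, dividedDiff_of_symm (swapVars_hom (by omega) _), hom_zero_right]
      ring
    have h1 := h.isSchubert_of_dividedDiff (i := k) (by rwa [e1])
    have := h1.eq_of_dividedDiff_eq (i := k) (j := p) (by rwa [e1]) (by rw [e1, e2])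
    omega
  | succ c ih =>
    refine ih (k := k + 1) (by omega) ?_
    have h1 := h.dividedDiff k
    rwa [dividedDiff_mul_of_right (hG _ hk.le), dividedDiff_add, dividedDiff_hom,
      dividedDiff_mul_of_right (swapVars_hom (by omega) _), dividedDiff_hom] at h1

theorem dividedDiff_hom_mul_hom_one (p a : ℕ) :
    dividedDiff (p + 1) (hom (p + 2) (a + 1) * hom (p + 2) 1) =
      hom (p + 3) (a + 1) + hom (p + 3) a * hom (p + 1) 1 := by
  have h1 := hom_succ_succ (p + 1) 0
  rw [hom_zero_right] at h1
  have e : hom (p + 2) (a + 1) * hom (p + 2) 1 =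
      X (p + 1) * hom (p + 2) (a + 1) + hom (p + 2) (a + 1) * hom (p + 1) 1 := by
    linear_combination hom (p + 2) (a + 1) * h1
  rw [e, dividedDiff_add, dividedDiff_X_mul_hom,
    dividedDiff_mul_of_right (swapVars_hom (by omega) _), dividedDiff_hom]

/-- The case division of the elementary version with the roles of the two factors exchanged: degree
1 of the first factor meets the second obstruction, then degree 1 of the second leads to the
excluded sum, and otherwise both degrees drop while `p` grows. -/
theorem not_isSchubertOrZero_hom_mul_hom_succ {n p a b : ℕ} {G : Poly}
    (hG : ∀ i, p ≤ i → swapVars i G = G) (hG0 : G ≠ 0) :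
    ¬ IsSchubertOrZero n (hom (p + 1) (a + 1) * hom (p + 2) (b + 1) * G) := by
  intro h
  have e1 : dividedDiff p (hom (p + 1) (a + 1) * hom (p + 2) (b + 1) * G) =
      hom (p + 2) a * hom (p + 2) (b + 1) * G := by
    rw [dividedDiff_mul_of_right (hG _ le_rfl), dividedDiff_mul_of_right
      (swapVars_hom (by omega) _), dividedDiff_hom]
  have e2 : dividedDiff p (dividedDiff (p + 1) (hom (p + 1) (a + 1) * hom (p + 2) (b + 1) * G)) =
      hom (p + 2) a * hom (p + 3) b * G := by
    rw [dividedDiff_mul_of_right (hG _ (by omega)), dividedDiff_mul_of_left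
      (swapVars_hom (by omega) _), dividedDiff_hom, dividedDiff_mul_of_right (hG _ le_rfl),
      dividedDiff_mul_of_right (swapVars_hom (by omega) _), dividedDiff_hom]
  induction a generalizing p b with
  | zero =>
    have e3 : dividedDiff (p + 1) (dividedDiff p
        (hom (p + 1) (0 + 1) * hom (p + 2) (b + 1) * G)) = hom (p + 3) b * G := by
      rw [e1, hom_zero_right, one_mul, dividedDiff_mul_of_right (hG _ (by omega)),
        dividedDiff_hom]
    have hne : hom (p + 3) b * G ≠ 0 := mul_ne_zero (hom_ne_zero _ _) hG0
    rw [hom_zero_right, one_mul] at e2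
    refine (h.isSchubert ?_).dividedDiff_dividedDiff_succ_ne (i := p) (by rwa [e2]) (by rw [e3, e2])
    exact mul_ne_zero (mul_ne_zero (hom_ne_zero _ _) (hom_ne_zero _ _)) hG0
  | succ a ih =>
    cases b with
    | zero =>
      refine not_isSchubertOrZero_hom_add_hom (k := p + 2) (p := p) (c := a) (n := n)
        (by omega) hG hG0 ?_
      have h1 := (h.dividedDiff p).dividedDiff (p + 1)
      rwa [e1, dividedDiff_mul_of_right (hG _ (by omega)), dividedDiff_hom_mul_hom_one] at h1
    | succ b =>
      have h1 := (h.dividedDiff (p + 1)).dividedDiff p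
      rw [e2] at h1
      have hG' : ∀ i, p + 1 ≤ i → swapVars i G = G := fun i hi => hG i (by omega)
      refine ih (p := p + 1) (b := b) hG' h1 ?_ ?_
      · rw [dividedDiff_mul_of_right (hG _ (by omega)), dividedDiff_mul_of_right
          (swapVars_hom (by omega) _), dividedDiff_hom]
      · rw [dividedDiff_mul_of_right (hG _ (by omega)), dividedDiff_mul_of_left
          (swapVars_hom (by omega) _), dividedDiff_hom, dividedDiff_mul_of_right (hG _ (by omega)),
          dividedDiff_mul_of_right (swapVars_hom (by omega) _), dividedDiff_hom]

theorem not_isSchubertOrZero_hom_mul_hom {n p a b s : ℕ} {G : Poly} (hs : s ≤ a)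
    (hG : ∀ i, p ≤ i → swapVars i G = G) (hG0 : G ≠ 0) :
    ¬ IsSchubertOrZero n (hom (p + 1) (a + 1) * hom (p + 1 + s + 1) (b + 1) * G) := by
  intro h
  induction s generalizing p a with
  | zero => exact not_isSchubertOrZero_hom_mul_hom_succ hG hG0 h
  | succ s ih =>
    obtain ⟨a, rfl⟩ : ∃ a', a = a' + 1 := ⟨a - 1, by omega⟩
    refine ih (p := p + 1) (a := a) (by omega) (fun i hi => hG i (by omega)) ?_
    have h1 := h.dividedDiff p
    rwa [dividedDiff_mul_of_right (hG _ le_rfl),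
      dividedDiff_mul_of_right (swapVars_hom (by omega) _), dividedDiff_hom,
      show p + 1 + (s + 1) + 1 = p + 1 + 1 + s + 1 by omega] at h1

/-- The operators at `i, …, i + d` act in turn with nonzero results, and the last of these positions
must satisfy `i + d + 1 < n`. -/
theorem IsSchubertOrZero.le_of_hom_mul {n i d : ℕ} {Q : Poly}
    (hQ : ∀ j, i ≤ j → swapVars j Q = Q) (hQ0 : Q ≠ 0)
    (h : IsSchubertOrZero n (hom (i + 1) (d + 1) * Q)) : i + 1 + (d + 1) ≤ n := by
  have h1 := h.dividedDiff i
  have e : Schubert.dividedDiff i (hom (i + 1) (d + 1) * Q) = hom (i + 2) d * Q := by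
    rw [dividedDiff_mul_of_right (hQ i le_rfl), dividedDiff_hom]
  induction d generalizing i with
  | zero =>
    have hne : hom (i + 2) 0 * Q ≠ 0 := mul_ne_zero (hom_ne_zero _ _) hQ0
    have := (h.isSchubert_of_dividedDiff (i := i) (by rwa [e])).lt_of_dividedDiff_ne_zero
      (i := i) (by rwa [e])
    omega
  | succ d ih =>
    rw [e] at h1
    have := ih (i := i + 1) (fun j hj => hQ j (by omega)) h1 (h1.dividedDiff _) (by
      rw [dividedDiff_mul_of_right (hQ _ (by omega)), dividedDiff_hom])
    omega

/-- The exponents of the complete homogeneous monomials that are Schubert polynomials of `S_n`. -/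
def IsSchubertCHM (n : ℕ) (a : ℕ →₀ ℕ) : Prop :=
  ∀ i, a i ≠ 0 → i + 1 + a i ≤ n ∧ ∀ j, i < j → a j ≠ 0 → i + a i < j

theorem isSchubertCHM_of_isSchubert {n : ℕ} {a : ℕ →₀ ℕ}
    (h : IsSchubert n (a.prod fun k d => hom (k + 1) d)) : IsSchubertCHM n a := by
  obtain ⟨N, hN⟩ := exists_forall_eq_zero_of_le a
  rw [finsuppProd_eq_prod_range (fun k => hom_zero_right _) hN] at h
  intro i hi
  have hmem : ∀ k, a k ≠ 0 → k < N := fun k hk => by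
    by_contra hc
    exact hk (hN k (by omega))
  have htail : ∀ m, m ≤ N →
      IsSchubertOrZero n (∏ k ∈ Finset.range m, hom (k + 1) (a k)) := by
    intro m hm
    obtain ⟨s, rfl⟩ : ∃ s, N = m + s := ⟨N - m, by omega⟩
    rw [← Finset.prod_range_mul_prod_Ico _ hm, mul_comm] at h
    exact IsSchubertOrZero.of_prod_hom_mul
      (fun i hi => swapVars_prod_hom _ (by simpa using hi)) (Or.inr h)
  obtain ⟨d, hd⟩ : ∃ d, a i = d + 1 := ⟨a i - 1, by omega⟩
  constructor
  · have h1 := htail (i + 1) (hmem i hi)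
    rw [Finset.prod_range_succ, mul_comm, hd] at h1
    rw [hd]
    exact h1.le_of_hom_mul (fun j hj => swapVars_prod_hom _ (by simpa using hj))
      (prod_hom_ne_zero _ _)
  · intro j hij hj
    by_contra hc
    classical
    have hex : ∃ j, i < j ∧ a j ≠ 0 := ⟨j, hij, hj⟩
    have hle := Nat.find_min' hex ⟨hij, hj⟩
    obtain ⟨hij', hj'⟩ := Nat.find_spec hex
    have hmin : ∀ k, k < Nat.find hex → i < k → a k = 0 := fun k hk hik => by
      by_contra hk0
      exact Nat.find_min hex hk ⟨hik, hk0⟩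
    generalize Nat.find hex = j' at hle hij' hj' hmin
    obtain ⟨s, rfl⟩ : ∃ s, j' = i + 1 + s := ⟨j' - (i + 1), by omega⟩
    have h1 : ∏ k ∈ Finset.Ico (i + 1) (i + 1 + s), hom (k + 1) (a k) = 1 := by
      refine Finset.prod_eq_one fun k hk => ?_
      rw [Finset.mem_Ico] at hk
      rw [hmin k hk.2 (by omega), hom_zero_right]
    have h2 := htail (i + 1 + s + 1) (hmem _ hj')
    obtain ⟨c, hc1⟩ : ∃ c, a (i + 1 + s) = c + 1 := ⟨a (i + 1 + s) - 1, by omega⟩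
    rw [Finset.prod_range_succ, ← Finset.prod_range_mul_prod_Ico _ (show i + 1 ≤ i + 1 + s by omega),
      h1, mul_one, Finset.prod_range_succ, hd, hc1, mul_assoc, mul_comm] at h2
    exact not_isSchubertOrZero_hom_mul_hom (by omega)
      (fun j hj => swapVars_prod_hom _ (by simpa using hj)) (prod_hom_ne_zero _ _) h2

theorem eq_of_hom_mul_eq {k d d' : ℕ} {Q Q' : Poly}
    (hQ : ∀ i, k ≤ i → swapVars i Q = Q) (hQ' : ∀ i, k ≤ i → swapVars i Q' = Q')
    (hQ0 : Q ≠ 0) (hQ0' : Q' ≠ 0) (h : hom (k + 1) d * Q = hom (k + 1) d' * Q') : d = d' := by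
  have h1 := congrArg (dividedDiff k) h
  rw [dividedDiff_mul_of_right (hQ k le_rfl), dividedDiff_mul_of_right (hQ' k le_rfl)] at h1
  induction d generalizing k d' with
  | zero =>
    cases d' with
    | zero => rfl
    | succ d' =>
      rw [hom_zero_right, dividedDiff_of_symm (map_one _), dividedDiff_hom, zero_mul] at h1
      exact absurd h1.symm (mul_ne_zero (hom_ne_zero _ _) hQ0')
  | succ d ih =>
    cases d' with
    | zero =>
      rw [hom_zero_right, dividedDiff_of_symm (map_one _), dividedDiff_hom, zero_mul] at h1
      exact absurd h1 (mul_ne_zero (hom_ne_zero _ _) hQ0)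
    | succ d' =>
      rw [dividedDiff_hom, dividedDiff_hom] at h1
      have h2 := congrArg (dividedDiff (k + 1)) h1
      rw [dividedDiff_mul_of_right (hQ _ (by omega)),
        dividedDiff_mul_of_right (hQ' _ (by omega))] at h2
      rw [ih (d' := d') (fun i hi => hQ i (by omega)) (fun i hi => hQ' i (by omega)) h1 h2]

theorem eq_of_prod_hom_eq {a b : ℕ →₀ ℕ}
    (h : (a.prod fun k d => hom (k + 1) d) = b.prod fun k d => hom (k + 1) d) : a = b := by
  obtain ⟨N, hN⟩ := exists_forall_eq_zero_of_le a
  obtain ⟨N', hN'⟩ := exists_forall_eq_zero_of_le b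
  have hNa : ∀ k, max N N' ≤ k → a k = 0 := fun k hk => hN k (le_trans (le_max_left _ _) hk)
  have hNb : ∀ k, max N N' ≤ k → b k = 0 := fun k hk => hN' k (le_trans (le_max_right _ _) hk)
  generalize max N N' = m at hNa hNb
  rw [finsuppProd_eq_prod_range (fun k => hom_zero_right _) hNa,
    finsuppProd_eq_prod_range (fun k => hom_zero_right _) hNb] at h
  have key : ∀ m, ∏ k ∈ Finset.range m, hom (k + 1) (a k) =
      ∏ k ∈ Finset.range m, hom (k + 1) (b k) → ∀ k, k < m → a k = b k := by
    intro m
    induction m with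
    | zero => intro _ k hk; omega
    | succ m ih =>
      intro he k hk
      rw [Finset.prod_range_succ, Finset.prod_range_succ, mul_comm, mul_comm _ (hom _ (b m))] at he
      have hab : a m = b m := eq_of_hom_mul_eq
        (fun i hi => swapVars_prod_hom _ (by simpa using hi))
        (fun i hi => swapVars_prod_hom _ (by simpa using hi))
        (prod_hom_ne_zero _ _) (prod_hom_ne_zero _ _) he
      by_cases hkm : k = m
      · rw [hkm, hab]
      · rw [hab] at he
        exact ih (mul_left_cancel₀ (hom_ne_zero _ _) he) k (by omega)
  refine Finsupp.ext fun k => ?_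
  by_cases hk : k < m
  · exact key m h k hk
  · rw [hNa k (by omega), hNb k (by omega)]

/-! ### Positivity of the sum of the coefficients -/

/-- The sum of all partial derivatives. -/
def nabla : Derivation ℤ Poly Poly := mkDerivation ℤ fun _ => 1

/-- The sum of the coefficients. -/
def coeffSum : Poly →+* ℤ := eval fun _ => 1

theorem nabla_X (k : ℕ) : nabla (X k) = 1 := mkDerivation_X _ _ _

theorem nabla_swapVars (i : ℕ) (f : Poly) : nabla (swapVars i f) = swapVars i (nabla f) := by
  induction f using MvPolynomial.induction_on with
  | C a =>
    have h : ∀ a : ℤ, nabla (C a) = 0 := fun a => nabla.map_algebraMap a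
    rw [swapVars, rename_C, h, map_zero]
  | add p q hp hq => rw [map_add, map_add, map_add, map_add, hp, hq]
  | mul_X p k hp =>
    rw [map_mul, swapVars_X, Derivation.leibniz, Derivation.leibniz, hp, nabla_X, nabla_X, map_add]
    simp only [smul_eq_mul, map_mul, map_one, swapVars_X]

/-- `nabla` commutes with exchanging the variables and annihilates the denominator `X i - X (i +
1)`. -/
theorem nabla_dividedDiff (i : ℕ) (f : Poly) :
    nabla (dividedDiff i f) = dividedDiff i (nabla f) := by
  symm
  apply dividedDiff_eq_of_mul_eq
  have h := congrArg nabla (mul_dividedDiff i f)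
  rw [Derivation.leibniz, map_sub, map_sub, nabla_X, nabla_X, nabla_swapVars, sub_self, smul_zero,
    add_zero, smul_eq_mul] at h
  exact h

theorem coeffSum_monomial (l : ℕ →₀ ℕ) (c : ℤ) : coeffSum (monomial l c) = c := by
  simp [coeffSum, eval_monomial]

theorem coeffSum_swapVars (i : ℕ) (f : Poly) : coeffSum (swapVars i f) = coeffSum f := by
  rw [coeffSum, swapVars, eval_rename]
  rfl

theorem nabla_monomial (l : ℕ →₀ ℕ) (c : ℤ) :
    nabla (monomial l c) = ∑ i ∈ l.support, monomial (l - Finsupp.single i 1) (c * l i) := by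
  rw [nabla, mkDerivation_monomial, Finsupp.sum, Finset.smul_sum]
  refine Finset.sum_congr rfl fun i _ => ?_
  rw [smul_eq_mul, mul_one, smul_monomial, smul_eq_mul]

/-- Euler's identity evaluated at the all-ones point. -/
theorem coeffSum_nabla {f : Poly} {d : ℕ} (hf : f.IsHomogeneous d) :
    coeffSum (nabla f) = d * coeffSum f := by
  conv_lhs => rw [f.as_sum]
  conv_rhs => rw [f.as_sum]
  rw [map_sum, map_sum, map_sum, Finset.mul_sum]
  refine Finset.sum_congr rfl fun l hl => ?_
  rw [nabla_monomial, map_sum, coeffSum_monomial, hf.degree_eq_sum_deg_support hl]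
  simp only [coeffSum_monomial]
  rw [← Finset.mul_sum, mul_comm]
  simp

/-- Lowering one positive exponent of the staircase keeps it weakly decreasing, so each term of
`nabla` at the longest element is a multiple of a Schubert polynomial. Divided differences carry
this to all permutations, since they send Schubert polynomials to Schubert polynomials or zero. -/
theorem nabla_schubert_mem {n : ℕ} (w : Equiv.Perm (Fin n)) :
    nabla (schubert w) ∈ AddSubmonoid.closure
      {f | ∃ v : Equiv.Perm (Fin n), inv v + 1 = inv w ∧ schubert v = f} := by
  induction w using schubert_induction with
  | top =>
    have hs : ∀ a, n - 1 - a ≠ 0 → a ∈ Finset.range n := fun a ha =>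
      Finset.mem_range.2 (by omega)
    obtain ⟨l, hl⟩ : ∃ l : ℕ →₀ ℕ, ∀ k, l k = n - 1 - k :=
      ⟨Finsupp.onFinset (Finset.range n) (fun k => n - 1 - k) hs, fun _ => rfl⟩
    have htop : schubert (Fin.revPerm : Equiv.Perm (Fin n)) = monomial l 1 := by
      rw [schubert_longest, ← prod_X_pow_eq_monomial (n := n) (fun k hk => by rw [hl]; omega),
        Finset.prod_range]
      simp only [hl]
    have hdeg := isHomogeneous_schubert (Fin.revPerm : Equiv.Perm (Fin n))
    rw [htop] at hdeg ⊢
    have hd1 := hdeg.inj_right (isHomogeneous_monomial (1 : ℤ) rfl)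
      ((monomial_eq_zero).not.2 one_ne_zero)
    rw [nabla_monomial]
    refine sum_mem fun i hi => ?_
    have hv : ∀ k, (l - Finsupp.single i 1 : ℕ →₀ ℕ) k = n - 1 - k - if i = k then 1 else 0 := by
      intro k
      rw [Finsupp.tsub_apply, hl, Finsupp.single_apply]
    have hli := Finsupp.mem_support_iff.1 hi
    rw [hl] at hli
    obtain ⟨v, hv⟩ := isSchubert_monomial (n := n) (l := l - Finsupp.single i 1)
      (antitone_nat_of_succ_le fun k => by rw [hv, hv]; split_ifs <;> omega)
      (fun k => by rw [hv]; omega)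
    have e : monomial (l - Finsupp.single i 1) (1 * (l i : ℤ)) = l i • schubert v := by
      rw [hv, ← map_nsmul]
      simp
    rw [e]
    refine nsmul_mem ?_ _
    refine AddSubmonoid.subset_closure ⟨v, ?_, rfl⟩
    have h1 := isHomogeneous_schubert v
    rw [hv] at h1
    have h2 := h1.inj_right (isHomogeneous_monomial (1 : ℤ) rfl)
      ((monomial_eq_zero).not.2 one_ne_zero)
    have h3 : l - Finsupp.single i 1 + Finsupp.single i 1 = l :=
      tsub_add_cancel_of_le (Finsupp.single_le_iff.2 (by rw [hl]; omega))
    rw [h2, hd1]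
    conv_rhs => rw [← h3]
    simp
  | step w i hi ih =>
    rw [schubert_eq_of_ascent w i hi, nabla_dividedDiff]
    have hw := inv_mul_adj (isDescent_mul_adj hi)
    rw [mul_assoc, adj_mul_self, mul_one] at hw
    refine AddSubmonoid.closure_induction (motive := fun f _ => dividedDiff i f ∈ _) ?_ ?_ ?_ ih
    · rintro _ ⟨v, hv, rfl⟩
      rcases isAscent_or_isDescent v hi.1 with ha | hd
      · rw [dividedDiff_schubert_of_ascent v i ha]
        exact zero_mem _
      · rw [dividedDiff_schubert_of_descent v i hd]
        refine AddSubmonoid.subset_closure ⟨_, ?_, rfl⟩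
        have := inv_mul_adj hd
        omega
    · rw [dividedDiff_zero]
      exact zero_mem _
    · intro x y _ _ hx hy
      rw [dividedDiff_add]
      exact add_mem hx hy

/-- Induction on inversions: the degree times the coefficient sum is a sum of coefficient sums for
permutations with one inversion fewer. -/
theorem coeffSum_schubert_nonneg {n : ℕ} (w : Equiv.Perm (Fin n)) : 0 ≤ coeffSum (schubert w) := by
  induction hm : inv w using Nat.strong_induction_on generalizing w with
  | _ m ih =>
    rcases Nat.eq_zero_or_pos m with rfl | hpos
    · rw [eq_one_of_inv_eq_zero hm, schubert_one, map_one]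
      exact zero_le_one
    · have h1 := coeffSum_nabla (isHomogeneous_schubert w)
      have h2 : 0 ≤ coeffSum (nabla (schubert w)) := by
        refine AddSubmonoid.closure_induction (motive := fun f _ => 0 ≤ coeffSum f) ?_ ?_ ?_
          (nabla_schubert_mem w)
        · rintro _ ⟨v, hv, rfl⟩
          exact ih _ (by omega) v rfl
        · rw [map_zero]
        · intro x y _ _ hx hy
          rw [map_add]
          exact add_nonneg hx hy
      rw [h1, hm] at h2
      exact nonneg_of_mul_nonneg_right h2 (by exact_mod_cast hpos)

/-! ### Single monomials -/

/-- L'Hôpital's rule at the all-ones point: differentiate the defining equation in `X i`, then set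
all variables to 1. -/
theorem coeffSum_dividedDiff (i : ℕ) (f : Poly) :
    coeffSum (dividedDiff i f) = coeffSum (pderiv i f) - coeffSum (pderiv (i + 1) f) := by
  have h := congrArg (fun g => coeffSum (pderiv i g)) (mul_dividedDiff i f)
  have hs : pderiv i (swapVars i f) = swapVars i (pderiv (i + 1) f) := by
    have := pderiv_rename (R := ℤ) (Equiv.swap i (i + 1)).injective (i + 1) f
    rw [Equiv.swap_apply_right] at this
    exact this
  have hx : ∀ k, coeffSum (X k) = 1 := fun k => by simp [coeffSum]
  have hi : pderiv i (X (i + 1) : Poly) = 0 := pderiv_X_of_ne (by omega)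
  simp only [Derivation.leibniz, map_sub, map_add, smul_eq_mul, map_mul, hs, coeffSum_swapVars, hx,
    hi, pderiv_X_self] at h
  simpa using h

theorem coeffSum_pderiv_monomial (i : ℕ) (l : ℕ →₀ ℕ) :
    coeffSum (pderiv i (monomial l 1)) = l i := by
  rw [pderiv_monomial, coeffSum_monomial, one_mul]

theorem IsSchubert.antitone_of_monomial {n : ℕ} {l : ℕ →₀ ℕ} (h : IsSchubert n (monomial l 1)) :
    Antitone l := by
  refine antitone_nat_of_succ_le fun i => ?_
  have h1 := coeffSum_dividedDiff i (monomial l 1)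
  rw [coeffSum_pderiv_monomial, coeffSum_pderiv_monomial] at h1
  have h2 : 0 ≤ coeffSum (Schubert.dividedDiff i (monomial l 1)) := by
    rcases IsSchubertOrZero.dividedDiff (Or.inr h) i with h0 | ⟨w, hw⟩
    · rw [h0, map_zero]
    · rw [← hw]
      exact coeffSum_schubert_nonneg w
  omega

theorem IsSchubert.le_of_monomial {n : ℕ} {l : ℕ →₀ ℕ} (h : IsSchubert n (monomial l 1)) (k : ℕ) :
    l k ≤ n - 1 - k := by
  obtain ⟨w, hw⟩ := h
  have := degreeOf_schubert_le w k
  rwa [hw, degreeOf_monomial_eq _ _ one_ne_zero] at this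

/-! ### Counting -/

theorem card_schubert_eq {n : ℕ} {F : (ℕ →₀ ℕ) → Poly} {s : Finset (ℕ →₀ ℕ)}
    (h : ∀ a, a ∈ s ↔ IsSchubert n (F a)) (hinj : Set.InjOn F s) :
    Nat.card {w : Equiv.Perm (Fin n) // ∃ a, schubert w = F a} = s.card := by
  have h1 : ∀ a : s, ∃ w : Equiv.Perm (Fin n), schubert w = F a := fun a => (h a).1 a.2
  choose g hg using h1
  have hb : Function.Bijective
      (fun a : s => (⟨g a, a, hg a⟩ : {w : Equiv.Perm (Fin n) // ∃ a, schubert w = F a})) := by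
    constructor
    · intro a b hab
      have h2 : g a = g b := congrArg Subtype.val hab
      exact Subtype.ext (hinj a.2 b.2 (by rw [← hg, ← hg, h2]))
    · rintro ⟨w, a, ha⟩
      have has : a ∈ s := (h a).2 ⟨w, ha⟩
      exact ⟨⟨a, has⟩, Subtype.ext (schubert_injective n (by rw [hg, ha]))⟩
  rw [← Nat.card_eq_of_bijective _ hb, Nat.card_eq_fintype_card, Fintype.card_coe]

theorem add_single_apply (a : ℕ →₀ ℕ) (m d k : ℕ) :
    (a + Finsupp.single m d : ℕ →₀ ℕ) k = a k + if m = k then d else 0 := by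
  rw [Finsupp.add_apply, Finsupp.single_apply]

theorem prod_add_single {F : ℕ → ℕ → Poly} (hF : ∀ k, F k 0 = 1) {a : ℕ →₀ ℕ} {m : ℕ}
    (ha : a m = 0) (d : ℕ) : (a + Finsupp.single m d).prod F = a.prod F * F m d := by
  rw [Finsupp.prod_add_index_of_disjoint, Finsupp.prod_single_index (hF m)]
  rw [Finset.disjoint_left]
  intro k hk hk2
  have := Finset.mem_singleton.1 (Finsupp.support_single_subset hk2)
  subst this
  exact Finsupp.mem_support_iff.1 hk ha

theorem finite_of_le {p : (ℕ →₀ ℕ) → Prop} {N : ℕ} {c : ℕ → ℕ}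
    (h : ∀ a, p a → ∀ k, a k ≤ if k < N then c k else 0) : {a | p a}.Finite := by
  refine (Set.finite_Iic (Finsupp.onFinset (Finset.range N)
    (fun k => if k < N then c k else 0) fun k hk => ?_)).subset fun a ha k => h a ha k
  by_contra hc
  rw [Finset.mem_range] at hc
  exact hk (if_neg hc)

/-! ### The number of standard elementary monomials -/

theorem IsSchubertSEM.eq_zero {n : ℕ} {a : ℕ →₀ ℕ} (h : IsSchubertSEM n a) {k : ℕ}
    (hk : n ≤ k + 1) : a k = 0 := by
  by_contra hc
  have := (h k hc).1
  omega

theorem IsSchubertSEM.le {n : ℕ} {a : ℕ →₀ ℕ} (h : IsSchubertSEM n a) (k : ℕ) : a k ≤ k + 1 := by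
  by_cases h0 : a k = 0
  · omega
  · exact (h k h0).2.1

theorem isSchubertSEM_finite (n : ℕ) : {a | IsSchubertSEM n a}.Finite :=
  finite_of_le (N := n) (c := fun k => k + 1) fun a ha k => by
    split_ifs with hk
    · exact ha.le k
    · exact (ha.eq_zero (by omega)).le

/-- Split off `d = a m` at the last admissible index. A full degree `d = m + 1` constrains nothing
before it. A smaller nonzero `d` requires `p + d < m` for the other nontrivial indices, which is the
range condition for `S_(m + 1 - d)`. The value `d = 0` fits the same formula. -/
theorem isSchubertSEM_add_two_iff {m : ℕ} {a : ℕ →₀ ℕ} :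
    IsSchubertSEM (m + 2) a ↔ ∃ d, d < m + 2 ∧ ∃ a',
      IsSchubertSEM (if d = m + 1 then m + 1 else m + 1 - d) a' ∧ a' + Finsupp.single m d = a := by
  constructor
  · intro h
    have hm := h.le m
    refine ⟨a m, by omega, a.erase m, ?_, Finsupp.erase_add_single m a⟩
    intro q hq
    have hqm : q ≠ m := by
      rintro rfl
      exact hq Finsupp.erase_same
    rw [Finsupp.erase_ne hqm] at hq ⊢
    obtain ⟨h1, h2, h3⟩ := h q hq
    refine ⟨?_, h2, fun hqq p hp hap => h3 hqq p hp ?_⟩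
    · split_ifs with hd
      · omega
      · by_cases h0 : a m = 0
        · omega
        · have := (h m h0).2.2 (by omega) q (by omega) hq
          omega
    · rwa [Finsupp.erase_ne (by omega)] at hap
  · rintro ⟨d, hd, a', ha', rfl⟩ q hq
    have hr : (if d = m + 1 then m + 1 else m + 1 - d) ≤ m + 1 := by split_ifs <;> omega
    have hm : a' m = 0 := ha'.eq_zero hr
    rw [add_single_apply] at hq ⊢
    by_cases hqm : m = q
    · subst hqm
      rw [if_pos rfl, hm, zero_add] at hq ⊢
      refine ⟨by omega, by omega, fun hdm p hp hap => ?_⟩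
      rw [add_single_apply, if_neg (by omega), add_zero] at hap
      have := (ha' p hap).1
      rw [if_neg (by omega)] at this
      omega
    · rw [if_neg hqm, add_zero] at hq ⊢
      obtain ⟨h1, h2, h3⟩ := ha' q hq
      refine ⟨by omega, h2, fun hqq p hp hap => h3 hqq p hp ?_⟩
      rwa [add_single_apply, if_neg (by omega), add_zero] at hap

theorem isSchubert_of_isSchubertSEM {n : ℕ} (hn : 1 ≤ n) {a : ℕ →₀ ℕ} (h : IsSchubertSEM n a) :
    IsSchubert n (a.prod fun k d => elem (k + 1) d) := by
  induction n using Nat.strong_induction_on generalizing a with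
  | _ n ih =>
    rcases hn.eq_or_lt with rfl | hn
    · have : a = 0 := Finsupp.ext fun k => h.eq_zero (by omega)
      rw [this, Finsupp.prod_zero_index]
      exact ⟨1, schubert_one 1⟩
    · obtain ⟨m, rfl⟩ : ∃ m, n = m + 2 := ⟨n - 2, by omega⟩
      obtain ⟨d, hd, a', ha', rfl⟩ := isSchubertSEM_add_two_iff.1 h
      have hr : (if d = m + 1 then m + 1 else m + 1 - d) ≤ m + 1 := by split_ifs <;> omega
      rw [prod_add_single (fun k => elem_zero_right _) (ha'.eq_zero hr)]
      split_ifs at ha' with hdm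
      · subst hdm
        exact (ih (m + 1) (by omega) (by omega) ha').mul_elem_self
      · have := (ih (m + 1 - d) (by omega) (by omega) ha').mul_elem d
        rwa [Nat.sub_add_cancel (by omega)] at this

theorem card_isSchubertSEM_add_two (m : ℕ) :
    (isSchubertSEM_finite (m + 2)).toFinset.card =
      ∑ j ∈ Finset.range (m + 1), (isSchubertSEM_finite (j + 1)).toFinset.card +
        (isSchubertSEM_finite (m + 1)).toFinset.card := by
  classical
  have hr : ∀ d, (if d = m + 1 then m + 1 else m + 1 - d) ≤ m + 1 := fun d => by
    split_ifs <;> omega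
  have e : (isSchubertSEM_finite (m + 2)).toFinset = (Finset.range (m + 2)).biUnion fun d =>
      (isSchubertSEM_finite (if d = m + 1 then m + 1 else m + 1 - d)).toFinset.image
        (· + Finsupp.single m d) := by
    ext a
    simp only [Set.Finite.mem_toFinset, Set.mem_ofPred_eq, Finset.mem_biUnion, Finset.mem_range,
      Finset.mem_image]
    exact isSchubertSEM_add_two_iff
  rw [e, Finset.card_biUnion]
  · simp only [Finset.card_image_of_injective _ (add_left_injective _)]
    -- The top term is the full degree. Reversing the sum matches the group sizes `m + 1 - d` for `d
    -- ≤ m` with `j + 1`.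
    rw [Finset.sum_range_succ, if_pos rfl, ← Finset.sum_range_reflect]
    congr 1
    refine Finset.sum_congr rfl fun d hd => ?_
    rw [Finset.mem_range] at hd
    have hc : ∀ r r', r = r' → (isSchubertSEM_finite r).toFinset.card =
        (isSchubertSEM_finite r').toFinset.card := by
      rintro r _ rfl
      rfl
    exact hc _ _ (by rw [if_neg (by omega)]; omega)
  · intro d _ d' _ hdd
    rw [Function.onFun, Finset.disjoint_left]
    intro x hx hx'
    simp only [Finset.mem_image, Set.Finite.mem_toFinset, Set.mem_ofPred_eq] at hx hx'
    obtain ⟨a, ha, rfl⟩ := hx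
    obtain ⟨b, hb, hab⟩ := hx'
    have h1 := DFunLike.congr_fun hab m
    rw [add_single_apply, add_single_apply, ha.eq_zero (hr d), hb.eq_zero (hr d')] at h1
    simp only [if_true, zero_add] at h1
    exact hdd h1.symm

theorem sum_fib_odd (m : ℕ) :
    ∑ j ∈ Finset.range m, Nat.fib (2 * j + 1) = Nat.fib (2 * m) := by
  induction m with
  | zero => simp
  | succ m ih =>
    rw [Finset.sum_range_succ, ih, show 2 * (m + 1) = 2 * m + 2 by ring, Nat.fib_add_two]

theorem card_isSchubertSEM (m : ℕ) :
    (isSchubertSEM_finite (m + 1)).toFinset.card = Nat.fib (2 * m + 1) := by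
  induction m using Nat.strong_induction_on with
  | _ m ih =>
    cases m with
    | zero =>
      have : (isSchubertSEM_finite (0 + 1)).toFinset = {0} := by
        ext a
        simp only [Set.Finite.mem_toFinset, Set.mem_ofPred_eq, Finset.mem_singleton]
        constructor
        · intro h
          exact Finsupp.ext fun k => h.eq_zero (by omega)
        · rintro rfl q hq
          exact absurd rfl hq
      rw [this]
      rfl
    | succ m =>
      rw [card_isSchubertSEM_add_two, ih m (by omega), Finset.sum_congr rfl fun j hj =>
        ih j (Finset.mem_range.1 hj), sum_fib_odd, show 2 * (m + 1) + 1 = 2 * m + 1 + 2 by ring,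
        Nat.fib_add_two (n := 2 * m + 1), add_comm]
      rfl

/-! ### The number of complete homogeneous monomials -/

theorem IsSchubertCHM.eq_zero {n : ℕ} {a : ℕ →₀ ℕ} (h : IsSchubertCHM n a) {k : ℕ}
    (hk : n ≤ k + 1) : a k = 0 := by
  by_contra hc
  have := (h k hc).1
  omega

theorem isSchubertCHM_finite (n : ℕ) : {a | IsSchubertCHM n a}.Finite :=
  finite_of_le (N := n) (c := fun _ => n) fun a ha k => by
    split_ifs with hk
    · by_cases h0 : a k = 0
      · omega
      · have := (ha k h0).1
        omega
    · exact (ha.eq_zero (by omega)).le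

/-- Here `m` is the start of the block containing the last point `n`. The remaining blocks form an
arbitrary admissible family on the `m` points before it. -/
theorem isSchubertCHM_succ_iff {n : ℕ} {a : ℕ →₀ ℕ} :
    IsSchubertCHM (n + 1) a ↔ ∃ m, m < n + 1 ∧ ∃ a',
      IsSchubertCHM m a' ∧ a' + Finsupp.single m (n - m) = a := by
  constructor
  · intro h
    by_cases hex : ∃ i, a i ≠ 0 ∧ i + a i = n
    · obtain ⟨i, hi, hin⟩ := hex
      refine ⟨i, by omega, a.erase i, ?_, ?_⟩
      · intro j hj
        have hji : j ≠ i := by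
          rintro rfl
          exact hj Finsupp.erase_same
        rw [Finsupp.erase_ne hji] at hj ⊢
        obtain ⟨h1, h2⟩ := h j hj
        have h3 := (h i hi).2 j
        refine ⟨?_, fun k hk hak => h2 k hk ?_⟩
        · by_cases hlt : j < i
          · have := h2 i hlt hi
            omega
          · have := h3 (by omega) hj
            omega
        · by_cases hki : k = i
          · rwa [hki]
          · rwa [Finsupp.erase_ne hki] at hak
      · rw [show n - i = a i by omega]
        exact Finsupp.erase_add_single i a
    · push Not at hex
      -- No interval reaches `n`: the last block is a single point and the added exponent is 0.
      refine ⟨n, by omega, a, fun i hi => ?_, by simp⟩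
      obtain ⟨h1, h2⟩ := h i hi
      have := hex i hi
      exact ⟨by omega, h2⟩
  · rintro ⟨m, hm, a', ha', rfl⟩ i hi
    rw [add_single_apply] at hi ⊢
    by_cases him : m = i
    · subst him
      rw [if_pos rfl, ha'.eq_zero (by omega), zero_add] at hi ⊢
      refine ⟨by omega, fun j hj haj => ?_⟩
      rw [add_single_apply, if_neg (by omega), ha'.eq_zero (by omega)] at haj
      exact absurd rfl haj
    · rw [if_neg him, add_zero] at hi ⊢
      obtain ⟨h1, h2⟩ := ha' i hi
      refine ⟨by omega, fun j hj haj => ?_⟩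
      rw [add_single_apply] at haj
      by_cases hmj : m = j
      · omega
      · rw [if_neg hmj, add_zero] at haj
        exact h2 j hj haj

theorem isSchubert_of_isSchubertCHM {n : ℕ} {a : ℕ →₀ ℕ} (h : IsSchubertCHM n a) :
    IsSchubert n (a.prod fun k d => hom (k + 1) d) := by
  induction n using Nat.strong_induction_on generalizing a with
  | _ n ih =>
    cases n with
    | zero =>
      have : a = 0 := Finsupp.ext fun k => h.eq_zero (by omega)
      rw [this, Finsupp.prod_zero_index]
      exact ⟨1, schubert_one 0⟩
    | succ n =>
      obtain ⟨m, hm, a', ha', rfl⟩ := isSchubertCHM_succ_iff.1 h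
      rw [prod_add_single (fun k => hom_zero_right _) (ha'.eq_zero (by omega))]
      have := (ih m hm ha').mul_hom (n - m)
      rwa [show m + 1 + (n - m) = n + 1 by omega] at this

theorem card_isSchubertCHM_succ (n : ℕ) :
    (isSchubertCHM_finite (n + 1)).toFinset.card =
      ∑ m ∈ Finset.range (n + 1), (isSchubertCHM_finite m).toFinset.card := by
  classical
  have e : (isSchubertCHM_finite (n + 1)).toFinset = (Finset.range (n + 1)).biUnion fun m =>
      (isSchubertCHM_finite m).toFinset.image (· + Finsupp.single m (n - m)) := by
    ext a
    simp only [Set.Finite.mem_toFinset, Set.mem_ofPred_eq, Finset.mem_biUnion, Finset.mem_range,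
      Finset.mem_image]
    exact isSchubertCHM_succ_iff
  -- Distinct starts give distinct vectors: an interval from `m` to `n` cannot fit among the first
  -- `m'` points.
  have key : ∀ m m' a b, m < m' → m' < n + 1 → IsSchubertCHM m a → IsSchubertCHM m' b →
      a + Finsupp.single m (n - m) ≠ b + Finsupp.single m' (n - m') := by
    intro m m' a b hmm hm' ha hb hab
    have h1 := DFunLike.congr_fun hab m
    rw [add_single_apply, add_single_apply, if_pos rfl, if_neg (by omega),
      ha.eq_zero (by omega)] at h1
    have := (hb m (by omega)).1
    omega
  rw [e, Finset.card_biUnion]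
  · simp only [Finset.card_image_of_injective _ (add_left_injective _)]
  · intro d hd d' hd' hdd
    rw [Function.onFun, Finset.disjoint_left]
    intro x hx hx'
    simp only [Finset.mem_image, Set.Finite.mem_toFinset, Set.mem_ofPred_eq, Finset.coe_range,
      Set.mem_Iio] at hx hx' hd hd'
    obtain ⟨a, ha, rfl⟩ := hx
    obtain ⟨b, hb, hab⟩ := hx'
    rcases Nat.lt_or_gt_of_ne hdd with h | h
    · exact key _ _ _ _ h hd' ha hb hab.symm
    · exact key _ _ _ _ h hd hb ha hab

theorem card_isSchubertCHM (n : ℕ) :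
    (isSchubertCHM_finite (n + 1)).toFinset.card = 2 ^ n := by
  have h0 : (isSchubertCHM_finite 0).toFinset.card = 1 := by
    have : (isSchubertCHM_finite 0).toFinset = {0} := by
      ext a
      simp only [Set.Finite.mem_toFinset, Set.mem_ofPred_eq, Finset.mem_singleton]
      constructor
      · intro h
        exact Finsupp.ext fun k => h.eq_zero (by omega)
      · rintro rfl q hq
        exact absurd rfl hq
    rw [this]
    rfl
  induction n with
  | zero => rw [card_isSchubertCHM_succ]; simpa using h0
  | succ n ih =>
    rw [card_isSchubertCHM_succ, Finset.sum_range_succ, ih, ← card_isSchubertCHM_succ, ih]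
    ring

/-! ### The number of weakly decreasing monomials -/

/-- The exponents that vanish before `p`, decrease weakly from `p` on, with `l p ≤ k` and
`l j ≤ N - j`. -/
def IsBallot (N p k : ℕ) (l : ℕ →₀ ℕ) : Prop :=
  (∀ j, j < p → l j = 0) ∧ (∀ j, p ≤ j → l (j + 1) ≤ l j) ∧ (∀ j, p ≤ j → l j ≤ N - j) ∧ l p ≤ k

theorem isBallot_finite (N p k : ℕ) : {l | IsBallot N p k l}.Finite :=
  finite_of_le (N := N) (c := fun _ => N) fun l hl k => by
    obtain ⟨h1, -, h2, -⟩ := hl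
    by_cases hk : k < p
    · rw [h1 k hk]; exact Nat.zero_le _
    · have := h2 k (by omega)
      split_ifs <;> omega

theorem isBallot_zero_iff {N p : ℕ} {l : ℕ →₀ ℕ} : IsBallot N p 0 l ↔ l = 0 := by
  constructor
  · rintro ⟨h1, h2, -, h4⟩
    refine Finsupp.ext fun k => ?_
    by_cases hk : k < p
    · exact h1 k hk
    · obtain ⟨s, rfl⟩ : ∃ s, k = p + s := ⟨k - p, by omega⟩
      clear hk
      induction s with
      | zero => simpa using h4
      | succ s ih =>
        have := h2 (p + s) (by omega)
        rw [ih] at this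
        exact Nat.le_zero.1 this
  · rintro rfl
    exact ⟨fun _ _ => rfl, fun _ _ => le_rfl, fun _ _ => Nat.zero_le _, le_rfl⟩

theorem isBallot_succ_iff_of_lt {N p k : ℕ} (h : N - p < k + 1) {l : ℕ →₀ ℕ} :
    IsBallot N p (k + 1) l ↔ IsBallot N p k l := by
  constructor
  · rintro ⟨h1, h2, h3, h4⟩
    exact ⟨h1, h2, h3, by have := h3 p le_rfl; omega⟩
  · rintro ⟨h1, h2, h3, h4⟩
    exact ⟨h1, h2, h3, by omega⟩

/-- Either the first entry is at most `k`, or it equals `k + 1` and is removed, leaving its value as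
the bound for the next entry. -/
theorem isBallot_succ_iff {N p k : ℕ} (h : k + 1 ≤ N - p) {l : ℕ →₀ ℕ} :
    IsBallot N p (k + 1) l ↔ IsBallot N p k l ∨
      ∃ l', IsBallot N (p + 1) (k + 1) l' ∧ l' + Finsupp.single p (k + 1) = l := by
  constructor
  · rintro ⟨h1, h2, h3, h4⟩
    by_cases hp : l p ≤ k
    · exact Or.inl ⟨h1, h2, h3, hp⟩
    · have hpk : l p = k + 1 := by omega
      refine Or.inr ⟨l.erase p, ⟨fun j hj => ?_, fun j hj => ?_, fun j hj => ?_, ?_⟩, ?_⟩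
      · by_cases hjp : j = p
        · rw [hjp, Finsupp.erase_same]
        · rw [Finsupp.erase_ne hjp]
          exact h1 j (by omega)
      · rw [Finsupp.erase_ne (by omega), Finsupp.erase_ne (by omega)]
        exact h2 j (by omega)
      · rw [Finsupp.erase_ne (by omega)]
        exact h3 j (by omega)
      · rw [Finsupp.erase_ne (by omega), ← hpk]
        exact h2 p le_rfl
      · rw [← hpk]
        exact Finsupp.erase_add_single p l
  · rintro (⟨h1, h2, h3, h4⟩ | ⟨l', ⟨h1, h2, h3, h4⟩, rfl⟩)
    · exact ⟨h1, h2, h3, by omega⟩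
    · have hp := h1 p (by omega)
      refine ⟨fun j hj => ?_, fun j hj => ?_, fun j hj => ?_, ?_⟩
      · rw [add_single_apply, if_neg (by omega), h1 j (by omega)]
      · rw [add_single_apply, add_single_apply, if_neg (by omega)]
        rcases hj.eq_or_lt with rfl | hj
        · rw [if_pos rfl]; omega
        · rw [if_neg (by omega)]
          exact h2 j hj
      · rw [add_single_apply]
        rcases hj.eq_or_lt with rfl | hj
        · rw [if_pos rfl]; omega
        · rw [if_neg (by omega)]
          exact h3 j hj
      · rw [add_single_apply, if_pos rfl, hp, zero_add]

theorem card_isBallot_succ {N p k : ℕ} (h : k + 1 ≤ N - p) :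
    (isBallot_finite N p (k + 1)).toFinset.card = (isBallot_finite N p k).toFinset.card +
      (isBallot_finite N (p + 1) (k + 1)).toFinset.card := by
  classical
  have e : (isBallot_finite N p (k + 1)).toFinset = (isBallot_finite N p k).toFinset ∪
      (isBallot_finite N (p + 1) (k + 1)).toFinset.image (· + Finsupp.single p (k + 1)) := by
    ext l
    simp only [Set.Finite.mem_toFinset, Set.mem_ofPred_eq, Finset.mem_union, Finset.mem_image]
    exact isBallot_succ_iff h
  rw [e, Finset.card_union_of_disjoint, Finset.card_image_of_injective _ (add_left_injective _)]
  rw [Finset.disjoint_left]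
  intro l hl hl'
  simp only [Set.Finite.mem_toFinset, Set.mem_ofPred_eq, Finset.mem_image] at hl hl'
  obtain ⟨l', -, rfl⟩ := hl'
  have := hl.2.2.2
  rw [add_single_apply, if_pos rfl] at this
  omega

theorem card_isBallot_zero (N p : ℕ) : (isBallot_finite N p 0).toFinset.card = 1 := by
  have : (isBallot_finite N p 0).toFinset = {0} := by
    ext l
    simpa using isBallot_zero_iff
  rw [this]
  rfl

/-- The ballot number as a difference of two binomials, written additively to avoid truncated
subtraction. For `k + 1 ≤ r` the recursion is Pascal's rule applied to both binomials. -/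
theorem card_isBallot {N p r k : ℕ} (hp : p + r = N) (hk : k ≤ r + 1) :
    (isBallot_finite N p k).toFinset.card + (r + 1 + k).choose (r + 2) =
      (r + 1 + k).choose (r + 1) := by
  induction r using Nat.strong_induction_on generalizing p k with
  | _ r ihr =>
    induction k with
    | zero => simp [card_isBallot_zero]
    | succ k ihk =>
      have h1 := ihk (by omega)
      have h2 := Nat.choose_succ_succ (r + 1 + k) (r + 1)
      have h3 := Nat.choose_succ_succ (r + 1 + k) r
      rw [Nat.succ_eq_add_one, Nat.succ_eq_add_one, add_assoc (r + 1)] at h2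
      rw [Nat.succ_eq_add_one, Nat.succ_eq_add_one, add_assoc (r + 1)] at h3
      rw [add_assoc r 1 1] at h2
      by_cases hkr : k + 1 ≤ r
      · have h4 := ihr (r - 1) (by omega) (p := p + 1) (k := k + 1) (by omega) (by omega)
        rw [show r - 1 + 1 + (k + 1) = r + 1 + k by omega, show r - 1 + 2 = r + 1 by omega,
          Nat.sub_add_cancel (by omega)] at h4
        have h5 := card_isBallot_succ (N := N) (p := p) (k := k) (by omega)
        norm_num at h2 h3 ⊢
        omega
      · obtain rfl : k = r := by omega
        have e : (isBallot_finite N p (k + 1)).toFinset = (isBallot_finite N p k).toFinset := by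
          ext l
          simp only [Set.Finite.mem_toFinset, Set.mem_ofPred_eq]
          exact isBallot_succ_iff_of_lt (by omega)
        -- At the boundary the bound `k + 1` is no stronger than `k`. The formula agrees because the
        -- two middle binomials of an odd row are equal.
        have h4 := Nat.choose_symm_half k
        rw [show 2 * k + 1 = k + 1 + k by ring] at h4
        rw [e]
        norm_num at h2 h3 ⊢
        omega

theorem card_isBallot_eq_catalan (N : ℕ) :
    (isBallot_finite N 0 (N + 1)).toFinset.card = catalan (N + 1) := by
  have h := card_isBallot (N := N) (p := 0) (r := N) (k := N + 1) (by omega) le_rfl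
  have h1 := Nat.choose_succ_right_eq (N + 1 + (N + 1)) (N + 1)
  have h2 := succ_mul_catalan_eq_centralBinom (N + 1)
  rw [Nat.centralBinom, show 2 * (N + 1) = N + 1 + (N + 1) by ring] at h2
  rw [Nat.add_sub_cancel] at h1
  apply Nat.eq_of_mul_eq_mul_left (show 0 < N + 1 + 1 by omega)
  rw [h2]
  simp only [add_assoc, Nat.reduceAdd] at h h1 ⊢
  nlinarith

theorem isSchubert_monomial_iff {N : ℕ} {l : ℕ →₀ ℕ} :
    IsBallot N 0 (N + 1) l ↔ IsSchubert (N + 1) (monomial l 1) := by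
  constructor
  · rintro ⟨-, h2, h3, -⟩
    exact isSchubert_monomial (antitone_nat_of_succ_le fun j => h2 j (Nat.zero_le j))
      fun j => h3 j (Nat.zero_le j)
  · intro h
    refine ⟨fun j hj => absurd hj (Nat.not_lt_zero j), fun j _ => ?_, fun j _ => ?_, ?_⟩
    · exact h.antitone_of_monomial (Nat.le_succ j)
    · exact h.le_of_monomial j
    · have := h.le_of_monomial 0
      omega

end Schubert

end

/-! ### The three counts. -/

theorem mainTheorem3 (n : ℕ) (hn : 1 ≤ n) :
    Nat.card {w : Equiv.Perm (Fin n) // Schubert.IsSingleMonomial (Schubert.schubert w)}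
        = catalan n ∧
    Nat.card {w : Equiv.Perm (Fin n) // Schubert.IsSingleSEM (Schubert.schubert w)}
        = Nat.fib (2 * n - 1) ∧
    Nat.card {w : Equiv.Perm (Fin n) // Schubert.IsSingleCHM (Schubert.schubert w)}
        = 2 ^ (n - 1) := by
  obtain ⟨N, rfl⟩ : ∃ N, n = N + 1 := ⟨n - 1, by omega⟩
  refine ⟨?_, ?_, ?_⟩
  · rw [← Schubert.card_isBallot_eq_catalan]
    refine Schubert.card_schubert_eq (fun l => ?_) fun l _ l' _ h => ?_
    · rw [Set.Finite.mem_toFinset]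
      exact Schubert.isSchubert_monomial_iff
    · exact MvPolynomial.monomial_left_injective (one_ne_zero) h
  · rw [show 2 * (N + 1) - 1 = 2 * N + 1 by omega, ← Schubert.card_isSchubertSEM]
    refine Schubert.card_schubert_eq (fun a => ?_) fun a ha b hb h => ?_
    · rw [Set.Finite.mem_toFinset]
      exact ⟨Schubert.isSchubert_of_isSchubertSEM hn, Schubert.isSchubertSEM_of_isSchubert⟩
    · rw [Set.Finite.coe_toFinset] at ha hb
      exact Schubert.eq_of_prod_elem_eq (Schubert.IsSchubertSEM.le ha)
        (Schubert.IsSchubertSEM.le hb) h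
  · rw [Nat.add_sub_cancel, ← Schubert.card_isSchubertCHM]
    refine Schubert.card_schubert_eq (fun a => ?_) fun a _ b _ h => ?_
    · rw [Set.Finite.mem_toFinset]
      exact ⟨Schubert.isSchubert_of_isSchubertCHM, Schubert.isSchubertCHM_of_isSchubert⟩
    · exact Schubert.eq_of_prod_hom_eq h
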